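/- Let $G$ be a finite group and let $Q$ be a finite $G$-monoid, i.e. a finite commutative monoid with unit on which $G$ acts by monoid automorphisms. We work over finite $G$-sets. A semi-Mackey functor $M=(M^*,M_*)$ is a contravariant functor $M^*$ and a covariant functor $M_*$ from finite $G$-sets to commutative monoids which agree on objects, satisfy $M^*(f)M_*(g)=M_*(g')M^*(f')$ for every pull-back square ($f\circ g'=g\circ f'$), and are such that $M^*$ turns direct sums into products. A semi-Tambara functor is a family of commutative semirings $S(X)$ with maps $f^*,f_+,f_\bullet$ for all $G$-maps $f$ such that $(S^*,S_+)$ and $(S^*,S_\bullet)$ are semi-Mackey functors for the additive, respectively multiplicative, monoid structures, and $\upsilon_+\eta'_\bullet\zeta^*=\eta_\bullet\xi_+$ for every exponential diagram, i.e. every diagram isomorphic to the one formed by $\eta\colon X\to Y$, $\xi=p\colon A\to X$, $\zeta=\lambda\colon X\times_Y\Pi_\eta(A)\to A$, $\eta'=\rho\colon X\times_Y\Pi_\eta(A)\to\Pi_\eta(A)$ and $\upsilon=\pi\colon\Pi_\eta(A)\to Y$. Here $\Pi_\eta(A)=\{(y,\sigma)\mid y\in Y,\ \sigma\colon\eta^{-1}(y)\to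 A,\ p\circ\sigma=\mathrm{id}\}$, $\rho$ and $\pi$ are the projections, and $\lambda(x,(y,\sigma))=\sigma(x)$. It is a Tambara functor if all $S(X)$ are rings. Morphisms are families of semiring homomorphisms compatible with all $f^*,f_+,f_\bullet$. A map from an additive commutative monoid to an abelian group is called algebraic if, for some $n$, all its $n$-fold iterated differences vanish. $K_0$ denotes the Grothendieck group (ring) of an additive commutative monoid (semiring). (a) For a semi-Mackey functor $M$, let $\mathcal S_M(X)$ be the semiring of isomorphism classes of pairs $(p\colon A\to X,\ m\in M(A))$, with disjoint union as sum and $(A_1\times_XA_2\to X,\ M^*(\varpi_1)(m_1)\cdot M^*(\varpi_2)(m_2))$ as product, where $\varpi_1,\varpi_2$ are the projections. Put $\zeta^*(A,m)=(A\times_XY\to Y,\ M^*(\mathrm{pr}_A)(m))$, $\xi_+(A\xrightarrow{p}X,m)=(A\xrightarrow{\xi p}Y,m)$ and $\eta_\bullet(A,m)=(\Pi_\eta(A)\xrightarrow{\pi}Y,\ M_*(\rho)M^*(\lambda)(m))$. The Tambarization is $\mathcal T_M(X)=K_0(\mathcal S_M(X))$; $f^*$ and $f_+$ are extended additively, and $f_\bullet$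 is extended to the unique algebraic map. The fixed point functor $\mathcal P_Q$ is the semi-Mackey functor $\mathcal P_Q(X)=\mathrm{Map}_G(X,Q)$, with $\mathcal P_Q^*(f)(\alpha)=\alpha\circ f$ and $\mathcal P_{Q*}(g)(\alpha)(y)=\prod_{x\in g^{-1}(y)}\alpha(x)$. (b) The crossed Burnside ring $\Omega_Q(X)$ is the Grothendieck ring of isomorphism classes of crossed $G$-sets $(p\colon A\to X,\ m\colon A\to Q)$ ($A$ a finite $G$-set, $p$ and $m$ being $G$-maps), with sum $(A_1\amalg A_2,\ m_1\cup m_2)$ and product $(A_1\times_XA_2,\ (a_1,a_2)\mapsto m_1(a_1)m_2(a_2))$. The map $f^*$ is induced by pull-back and $f_+$ by composition. The map $f_\bullet$, for $f\colon X\to Y$, is the composite $$\Omega_Q(X)\cong\Omega(X\times Q)\xrightarrow{e^*}\Omega(X\times_Y\Pi_f(X\times Q))\xrightarrow{f'_\bullet}\Omega(\Pi_f(X\times Q))\xrightarrow{(\mu_f)_+}\Omega(Y\times Q)\cong\Omega_Q(Y).$$ Here $\Omega(W)$ is the Burnside group of finite $G$-sets over $W$; the outer isomorphisms are the additive ones taking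 $(A,p,m)$ to $(p,m)\colon A\to X\times Q$, and similarly over $Y$; $\Pi_f(X\times Q)$ is formed with the projection $X\times Q\to X$; $e(x,(y,\sigma))=\sigma(x)$; $f'$ is the projection to $\Pi_f(X\times Q)$, and $f'_\bullet$ is the unique algebraic map with $[S]\mapsto[\Pi_{f'}(S)]$; and $\mu_f(y,\sigma)=(y,\prod_{x\in f^{-1}(y)}\mathrm{pr}_Q\,\sigma(x))$. **Proposition.** The algebraic extensions used to define the multiplicative transfers in (a) (for $M=\mathcal P_Q$) and in (b) exist and are unique. Both $\mathcal T_{\mathcal P_Q}$ and $\Omega_Q$ are Tambara functors on $G$, and there is a natural isomorphism of Tambara functors $$\varphi\colon\mathcal T_{\mathcal P_Q}\xrightarrow{\ \cong\ }\Omega_Q,$$ namely one with $\varphi_X\big([A\xrightarrow{p}X,\ m]\big)=[A\xrightarrow{p}X,\ m]$ for all finite $G$-sets $X$, all $G$-maps $p\colon A\to X$ with $A$ a finite $G$-set, and all $m\in\mathcal P_Q(A)=\mathrm{Map}_G(A,Q)$. -/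

import Mathlib

universe u w

namespace CrossedBurnside

open Function (Bijective bijective_id)

/-! ### Finite `G`-sets -/

/-- A finite `G`-set.  Morphisms of `G`-sets are the equivariant maps `X →[G] Y`. -/
structure FinGSet (G : Type u) [Group G] : Type (u + 1) where
  carrier : Type u
  [action : MulAction G carrier]
  [finite : Finite carrier]

namespace FinGSet

variable {G : Type u} [Group G]

instance : CoeSort (FinGSet G) (Type u) := ⟨FinGSet.carrier⟩

instance (X : FinGSet G) : MulAction G X := X.action

instance (X : FinGSet G) : Finite X := X.finite

/-- Composition of equivariant maps. -/
abbrev comp {X Y Z : FinGSet G} (g : Y →[G] Z) (f : X →[G] Y) : X →[G] Z := g.comp f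

/-- The identity map. -/
abbrev idm (X : FinGSet G) : X →[G] X := MulActionHom.id G

/-- The square with `f' : X' → X`, `g' : X' → Y'`, `g : X → Y`, `f : Y' → Y` is a pull-back. -/
def IsPullback {X' X Y' Y : FinGSet G} (f' : X' →[G] X) (g' : X' →[G] Y')
    (g : X →[G] Y) (f : Y' →[G] Y) : Prop :=
  (∀ a, g (f' a) = f (g' a)) ∧ ∀ x y, g x = f y → ∃! a, f' a = x ∧ g' a = y

/-- `Z` is the direct sum of `X` and `Y` via `i` and `j`. -/
def IsCoproduct {X Y Z : FinGSet G} (i : X →[G] Z) (j : Y →[G] Z) : Prop :=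
  Bijective (Sum.elim i j : X ⊕ Y → Z)

/-- The empty `G`-set. -/
def empty : FinGSet G where
  carrier := PEmpty
  action := { smul := fun _ x => x, one_smul := fun _ => rfl, mul_smul := fun _ _ _ => rfl }

instance : IsEmpty (empty : FinGSet G) := inferInstanceAs (IsEmpty PEmpty)

/-- The map from the empty `G`-set. -/
def fromEmpty (X : FinGSet G) : (empty : FinGSet G) →[G] X where
  toFun x := isEmptyElim x
  map_smul' _ x := isEmptyElim x

/-- The disjoint union `X ⨿ Y`. -/
def sum (X Y : FinGSet G) : FinGSet G where
  carrier := X ⊕ Y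

/-- First inclusion. -/
def inl (X Y : FinGSet G) : X →[G] X.sum Y where
  toFun := Sum.inl
  map_smul' _ _ := rfl

/-- Second inclusion. -/
def inr (X Y : FinGSet G) : Y →[G] X.sum Y where
  toFun := Sum.inr
  map_smul' _ _ := rfl

/-- The map `p ∪ q : X ⨿ Y → Z`. -/
def sumElim {X Y Z : FinGSet G} (p : X →[G] Z) (q : Y →[G] Z) : X.sum Y →[G] Z where
  toFun := Sum.elim p q
  map_smul' g x := by cases x <;> exact map_smul _ _ _

/-- The product `X × Y` with the diagonal action. -/
def prod (X Y : FinGSet G) : FinGSet G where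
  carrier := X × Y

/-- First projection. -/
def fst (X Y : FinGSet G) : X.prod Y →[G] X where
  toFun := Prod.fst
  map_smul' _ _ := rfl

/-- Second projection. -/
def snd (X Y : FinGSet G) : X.prod Y →[G] Y where
  toFun := Prod.snd
  map_smul' _ _ := rfl

/-- The map `(p, q) : A → X × Y`. -/
def pair {A X Y : FinGSet G} (p : A →[G] X) (q : A →[G] Y) : A →[G] X.prod Y where
  toFun a := (p a, q a)
  map_smul' g a := Prod.ext (map_smul p g a) (map_smul q g a)

/-- The fibre product `A ×_X B`. -/
def fiberProd {A B X : FinGSet G} (p : A →[G] X) (q : B →[G] X) : FinGSet G where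
  carrier := {c : A × B // p c.1 = q c.2}
  action :=
    { smul := fun g c => ⟨g • c.1, by simp [map_smul, c.2]⟩
      one_smul := fun c => Subtype.ext (one_smul G c.1)
      mul_smul := fun g h c => Subtype.ext (mul_smul g h c.1) }

/-- First projection of the fibre product. -/
def pfst {A B X : FinGSet G} (p : A →[G] X) (q : B →[G] X) : fiberProd p q →[G] A where
  toFun c := c.1.1
  map_smul' _ _ := rfl

/-- Second projection of the fibre product. -/
def psnd {A B X : FinGSet G} (p : A →[G] X) (q : B →[G] X) : fiberProd p q →[G] B where
  toFun c := c.1.2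
  map_smul' _ _ := rfl

/-- The map into a fibre product. -/
def plift {A B X C : FinGSet G} (p : A →[G] X) (q : B →[G] X) (a : C →[G] A) (b : C →[G] B)
    (h : ∀ c, p (a c) = q (b c)) : C →[G] fiberProd p q where
  toFun c := ⟨(a c, b c), h c⟩
  map_smul' g c := Subtype.ext (Prod.ext (map_smul a g c) (map_smul b g c))

lemma isPullback_fiberProd {A B X : FinGSet G} (p : A →[G] X) (q : B →[G] X) :
    IsPullback (pfst p q) (psnd p q) p q :=
  ⟨fun c => c.2, fun x y h => ⟨⟨(x, y), h⟩, ⟨rfl, rfl⟩, fun _ hc =>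
    Subtype.ext (Prod.ext hc.1 hc.2)⟩⟩

lemma fiberProd_ext {A B X : FinGSet G} {p : A →[G] X} {q : B →[G] X} {c d : fiberProd p q}
    (h1 : pfst p q c = pfst p q d) (h2 : psnd p q c = psnd p q d) : c = d :=
  Subtype.ext (Prod.ext h1 h2)

/-! ### Dependent products and exponential diagrams -/

/-- The set of pairs `(y, σ)` with `y ∈ Y` and `σ : η⁻¹(y) → A` a map of sets with
`p ∘ σ = id`. -/
def SectionPair {A X Y : FinGSet G} (η : X →[G] Y) (p : A →[G] X) : Type u :=
  Σ y : Y, {σ : {x : X // η x = y} → A // ∀ x, p (σ x) = x.1}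

lemma SectionPair.ext {A X Y : FinGSet G} {η : X →[G] Y} {p : A →[G] X} {s t : SectionPair η p}
    (h : s.1 = t.1) (h' : ∀ x hs ht, s.2.1 ⟨x, hs⟩ = t.2.1 ⟨x, ht⟩) : s = t := by
  obtain ⟨y, σ⟩ := s
  obtain ⟨z, τ⟩ := t
  obtain rfl : y = z := h
  have : σ = τ := Subtype.ext (funext fun x => h' x.1 x.2 x.2)
  rw [this]

lemma SectionPair.congr {A X Y : FinGSet G} {η : X →[G] Y} {p : A →[G] X} (s : SectionPair η p)
    {x x' : X} (h : x = x') (hx : η x = s.1) (hx' : η x' = s.1) :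
    s.2.1 ⟨x, hx⟩ = s.2.1 ⟨x', hx'⟩ := by
  subst h; rfl

/-- `G` acts by `g • (y, σ) = (g y, x ↦ g σ(g⁻¹ x))`. -/
instance {A X Y : FinGSet G} (η : X →[G] Y) (p : A →[G] X) : MulAction G (SectionPair η p) where
  smul g s := ⟨g • s.1, fun x => g • s.2.1 ⟨g⁻¹ • x.1, by rw [map_smul, x.2, inv_smul_smul]⟩,
    fun x => by rw [map_smul, s.2.2, smul_inv_smul]⟩
  one_smul s := SectionPair.ext (one_smul G s.1) fun x hs ht =>
    (one_smul G _).trans (SectionPair.congr s (by simp) _ _)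
  mul_smul g h s := SectionPair.ext (mul_smul g h s.1) fun x hs ht =>
    (mul_smul g h _).trans (congrArg (fun a => g • h • a)
      (SectionPair.congr s (by simp [mul_smul]) _ _))

/-- The finite `G`-set `Π_η(A)`. -/
def dprod {A X Y : FinGSet G} (η : X →[G] Y) (p : A →[G] X) : FinGSet G where
  carrier := SectionPair η p
  finite := by unfold SectionPair; infer_instance

/-- The projection `π : Π_η(A) → Y`. -/
def dproj {A X Y : FinGSet G} (η : X →[G] Y) (p : A →[G] X) : dprod η p →[G] Y where
  toFun s := s.1
  map_smul' _ _ := rfl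

/-- The evaluation `λ : X ×_Y Π_η(A) → A`, `(x, (y, σ)) ↦ σ(x)`. -/
def deval {A X Y : FinGSet G} (η : X →[G] Y) (p : A →[G] X) :
    fiberProd η (dproj η p) →[G] A where
  toFun c := c.1.2.2.1 ⟨c.1.1, c.2⟩
  map_smul' g c := congrArg (fun a => g • a)
    (SectionPair.congr (x := g⁻¹ • g • c.1.1) c.1.2 (inv_smul_smul _ _) _ _)

/-- The diagram
```
X ←ξ- Z ←ζ- X'
|η          |η'
Y ←--- υ -- Y'
```
is an exponential diagram, i.e. isomorphic to the diagram formed by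
`X ← Z ← X ×_Y Π_η(Z) → Π_η(Z) → Y`. -/
def IsExponential {X Y Z X' Y' : FinGSet G} (η : X →[G] Y) (ξ : Z →[G] X) (ζ : X' →[G] Z)
    (η' : X' →[G] Y') (υ : Y' →[G] Y) : Prop :=
  ∃ (b : Y' →[G] dprod η ξ) (c : X' →[G] fiberProd η (dproj η ξ)), Bijective b ∧ Bijective c ∧
    (∀ y, dproj η ξ (b y) = υ y) ∧ (∀ x, psnd η (dproj η ξ) (c x) = b (η' x)) ∧
    ∀ x, deval η ξ (c x) = ζ x

end FinGSet

open FinGSet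

/-! ### Semi-Mackey functors -/

section Mackey

variable (G : Type u) [Group G]

/-- The axioms on the contravariant part `res` and the covariant part `tr` of a semi-Mackey
functor: functoriality, Mackey condition and additivity (for finite `G`-sets, additivity for all
direct sum decompositions amounts to the empty and the binary case). -/
structure IsSemiMackey (M : FinGSet G → Type w)
    (res : ∀ {X Y : FinGSet G}, (X →[G] Y) → M Y → M X)
    (tr : ∀ {X Y : FinGSet G}, (X →[G] Y) → M X → M Y) : Prop where
  res_id : ∀ (X : FinGSet G) (m : M X), res (idm X) m = m
  res_comp : ∀ {X Y Z : FinGSet G} (g : Y →[G] Z) (f : X →[G] Y) (m : M Z),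
    res (comp g f) m = res f (res g m)
  tr_id : ∀ (X : FinGSet G) (m : M X), tr (idm X) m = m
  tr_comp : ∀ {X Y Z : FinGSet G} (g : Y →[G] Z) (f : X →[G] Y) (m : M X),
    tr (comp g f) m = tr g (tr f m)
  mackey : ∀ {X' X Y' Y : FinGSet G} (f' : X' →[G] X) (g' : X' →[G] Y') (g : X →[G] Y)
    (f : Y' →[G] Y), IsPullback f' g' g f → ∀ m : M X, res f (tr g m) = tr g' (res f' m)
  subsingleton : ∀ X : FinGSet G, IsEmpty X → Subsingleton (M X)
  additive : ∀ {X Y Z : FinGSet G} (i : X →[G] Z) (j : Y →[G] Z), IsCoproduct i j →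
    Bijective fun m : M Z => (res i m, res j m)

/-- A semi-Mackey functor on the finite group `G`: `res f = M^*(f)` and `tr f = M_*(f)`. -/
structure SemiMackeyFunctor : Type (max (u + 1) (w + 1)) where
  obj : FinGSet G → Type w
  [monoid : ∀ X, CommMonoid (obj X)]
  res : ∀ {X Y : FinGSet G}, (X →[G] Y) → (obj Y →* obj X)
  tr : ∀ {X Y : FinGSet G}, (X →[G] Y) → (obj X →* obj Y)
  isSemiMackey : IsSemiMackey G obj (fun f => res f) (fun f => tr f)

instance (M : SemiMackeyFunctor G) (X : FinGSet G) : CommMonoid (M.obj X) := M.monoid X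

/-! ### Tambara functors -/

/-- A family of commutative semirings indexed by finite `G`-sets, with maps `f^*`, `f_+`, `f_•`
for each equivariant map `f`. -/
structure TambaraData : Type (max (u + 1) (w + 1)) where
  obj : FinGSet G → Type w
  [semiring : ∀ X, CommSemiring (obj X)]
  res : ∀ {X Y : FinGSet G}, (X →[G] Y) → (obj Y →+* obj X)
  tr : ∀ {X Y : FinGSet G}, (X →[G] Y) → (obj X →+ obj Y)
  nm : ∀ {X Y : FinGSet G}, (X →[G] Y) → obj X → obj Y

instance (T : TambaraData G) (X : FinGSet G) : CommSemiring (T.obj X) := T.semiring X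

variable {G}

/-- `(S^*, S_+, S_•)` is a semi-Tambara functor. -/
structure TambaraData.IsSemiTambara (S : TambaraData.{u, w} G) : Prop where
  additive : IsSemiMackey G S.obj (fun f => S.res f) (fun f => S.tr f)
  multiplicative : IsSemiMackey G S.obj (fun f => S.res f) (fun f => S.nm f)
  nm_one : ∀ {X Y : FinGSet G} (f : X →[G] Y), S.nm f 1 = 1
  nm_mul : ∀ {X Y : FinGSet G} (f : X →[G] Y) (a b : S.obj X),
    S.nm f (a * b) = S.nm f a * S.nm f b
  exponential : ∀ {X Y Z X' Y' : FinGSet G} (η : X →[G] Y) (ξ : Z →[G] X) (ζ : X' →[G] Z)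
    (η' : X' →[G] Y') (υ : Y' →[G] Y), IsExponential η ξ ζ η' υ →
    ∀ a : S.obj Z, S.tr υ (S.nm η' (S.res ζ a)) = S.nm η (S.tr ξ a)

/-- A Tambara functor is a semi-Tambara functor whose values are rings. -/
structure TambaraData.IsTambara (T : TambaraData.{u, w} G) : Prop extends T.IsSemiTambara where
  exists_neg : ∀ (X : FinGSet G) (a : T.obj X), ∃ b, a + b = 0

variable (G)

/-- A Tambara functor on the finite group `G`. -/
structure TambaraFunctor : Type (max (u + 1) (w + 1)) where
  toData : TambaraData.{u, w} G
  isTambara : toData.IsTambara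

variable {G}

/-- A morphism of Tambara functors. -/
@[ext]
structure TambaraFunctor.Hom (S T : TambaraFunctor.{u, w} G) : Type (max (u + 1) w) where
  app : ∀ X : FinGSet G, S.toData.obj X →+* T.toData.obj X
  app_res : ∀ {X Y : FinGSet G} (f : X →[G] Y) (a : S.toData.obj Y),
    app X (S.toData.res f a) = T.toData.res f (app Y a)
  app_tr : ∀ {X Y : FinGSet G} (f : X →[G] Y) (a : S.toData.obj X),
    app Y (S.toData.tr f a) = T.toData.tr f (app X a)
  app_nm : ∀ {X Y : FinGSet G} (f : X →[G] Y) (a : S.toData.obj X),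
    app Y (S.toData.nm f a) = T.toData.nm f (app X a)

/-- The category of Tambara functors on `G`. -/
instance : CategoryTheory.Category (TambaraFunctor.{u, w} G) where
  Hom S T := TambaraFunctor.Hom S T
  id S := ⟨fun X => RingHom.id _, fun _ _ => rfl, fun _ _ => rfl, fun _ _ => rfl⟩
  comp φ ψ := ⟨fun X => (ψ.app X).comp (φ.app X),
    fun f a => by simp [φ.app_res, ψ.app_res],
    fun f a => by simp [φ.app_tr, ψ.app_tr],
    fun f a => by simp [φ.app_nm, ψ.app_nm]⟩

end Mackey

/-! ### Grothendieck rings and algebraic maps -/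

section Grothendieck

open Algebra

/-- `φ` has degree `< n`: all its `n`-fold differences vanish. -/
def DegreeLT {M N : Type*} [AddCommMonoid M] [AddCommGroup N] : ℕ → (M → N) → Prop
  | 0, φ => ∀ x, φ x = 0
  | n + 1, φ => ∀ a, DegreeLT n (fwdDiff a φ)

/-- `φ` is an algebraic map (of some finite degree). -/
def IsAlgebraicMap {M N : Type*} [AddCommMonoid M] [AddCommGroup N] (φ : M → N) : Prop :=
  ∃ n, DegreeLT n φ

/-- `g` is an algebraic map on the Grothendieck group of `M` extending `φ : M → N`. -/
def IsAlgebraicExtension {M N : Type*} [AddCommMonoid M] [AddCommGroup N] (φ : M → N)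
    (g : GrothendieckAddGroup M → N) : Prop :=
  IsAlgebraicMap g ∧ ∀ m, g (GrothendieckAddGroup.of m) = φ m

open Classical in
/-- The algebraic map on the Grothendieck group extending `φ`. -/
noncomputable def algExt {M N : Type*} [AddCommMonoid M] [AddCommGroup N] (φ : M → N) :
    GrothendieckAddGroup M → N :=
  if h : ∃ g, IsAlgebraicExtension φ g then h.choose else 0

/-- The additive map of Grothendieck groups induced by an additive map of monoids. -/
noncomputable def groupMap {M N : Type*} [AddCommMonoid M] [AddCommMonoid N] (f : M →+ N) :
    GrothendieckAddGroup M →+ GrothendieckAddGroup N :=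
  GrothendieckAddGroup.lift (GrothendieckAddGroup.of.comp f)

/-- The ring completion of a commutative semiring. -/
def K0 (S : Type w) [CommSemiring S] : Type w := GrothendieckAddGroup S

variable {S : Type w} [CommSemiring S]

instance : AddCommGroup (K0 S) := inferInstanceAs (AddCommGroup (GrothendieckAddGroup S))

/-- The class of an element in the ring completion. -/
def K0.of : S →+ K0 S := (GrothendieckAddGroup.of : S →+ GrothendieckAddGroup S)

/-- Universal property of the ring completion as an additive group. -/
noncomputable def K0.lift {N : Type*} [AddCommGroup N] (f : S →+ N) : K0 S →+ N :=
  (GrothendieckAddGroup.lift f : GrothendieckAddGroup S →+ N)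

lemma K0.lift_of {N : Type*} [AddCommGroup N] (f : S →+ N) (s : S) :
    K0.lift f (K0.of s) = f s :=
  DFunLike.congr_fun (GrothendieckAddGroup.lift.symm_apply_apply f) s

lemma K0.hom_ext {N : Type*} [AddCommGroup N] {f g : K0 S →+ N}
    (h : ∀ s, f (K0.of s) = g (K0.of s)) : f = g :=
  (GrothendieckAddGroup.lift (M := S) (G := N)).symm.injective (AddMonoidHom.ext h)

/-- Multiplication on the ring completion, as a biadditive map. -/
noncomputable def K0.mulHom : K0 S →+ K0 S →+ K0 S :=
  K0.lift
    { toFun := fun s => K0.lift (K0.of.comp (AddMonoidHom.mulLeft s))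
      map_zero' := K0.hom_ext fun t => by simp [K0.lift_of]
      map_add' := fun a b => K0.hom_ext fun t => by simp [K0.lift_of, add_mul] }

lemma K0.mulHom_of (s t : S) : K0.mulHom (K0.of s) (K0.of t) = K0.of (s * t) := by
  simp [K0.mulHom, K0.lift_of]

lemma K0.hom_ext₂ {N : Type*} [AddCommGroup N] {f g : K0 S →+ K0 S →+ N}
    (h : ∀ s t, f (K0.of s) (K0.of t) = g (K0.of s) (K0.of t)) : f = g :=
  K0.hom_ext fun s => K0.hom_ext fun t => h s t

lemma K0.mul_comm' (a b : K0 S) : K0.mulHom a b = K0.mulHom b a := by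
  have : (K0.mulHom : K0 S →+ K0 S →+ K0 S) = K0.mulHom.flip :=
    K0.hom_ext₂ fun s t => by simp [K0.mulHom_of, mul_comm]
  exact DFunLike.congr_fun (DFunLike.congr_fun this a) b

lemma K0.one_mul' (a : K0 S) : K0.mulHom (K0.of 1) a = a := by
  have : K0.mulHom (K0.of (1 : S)) = AddMonoidHom.id _ :=
    K0.hom_ext fun s => by simp [K0.mulHom_of]
  exact DFunLike.congr_fun this a

lemma K0.mul_assoc' (a b c : K0 S) :
    K0.mulHom (K0.mulHom a b) c = K0.mulHom a (K0.mulHom b c) := by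
  have h1 : ∀ (s t : S) (c : K0 S), K0.mulHom (K0.mulHom (K0.of s) (K0.of t)) c =
      K0.mulHom (K0.of s) (K0.mulHom (K0.of t) c) := fun s t => by
    have : K0.mulHom (K0.mulHom (K0.of s) (K0.of t)) =
        (K0.mulHom (K0.of s)).comp (K0.mulHom (K0.of t)) :=
      K0.hom_ext fun r => by simp [K0.mulHom_of, mul_assoc]
    exact fun c => DFunLike.congr_fun this c
  have : (K0.mulHom.flip c).comp (K0.mulHom a) = (K0.mulHom a).comp (K0.mulHom.flip c) := by
    refine K0.hom_ext fun t => ?_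
    have : ((K0.mulHom.flip c).comp (K0.mulHom.flip (K0.of t)) : K0 S →+ K0 S) =
        K0.mulHom.flip (K0.mulHom (K0.of t) c) :=
      K0.hom_ext fun s => by simpa using h1 s t c
    simpa using DFunLike.congr_fun this a
  simpa using DFunLike.congr_fun this b

noncomputable instance : CommRing (K0 S) where
  __ := (inferInstance : AddCommGroup (K0 S))
  mul a b := K0.mulHom a b
  one := K0.of 1
  mul_assoc := K0.mul_assoc'
  one_mul := K0.one_mul'
  mul_one a := (K0.mul_comm' a _).trans (K0.one_mul' a)
  mul_comm := K0.mul_comm'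
  left_distrib a b c := map_add (K0.mulHom a) b c
  right_distrib a b c := DFunLike.congr_fun (map_add K0.mulHom a b) c
  zero_mul a := DFunLike.congr_fun (map_zero K0.mulHom) a
  mul_zero a := map_zero (K0.mulHom a)

lemma K0.of_one : K0.of (1 : S) = 1 := rfl

lemma K0.of_mul (s t : S) : K0.of (s * t) = K0.of s * K0.of t := (K0.mulHom_of s t).symm

variable {T : Type*} [CommSemiring T]

/-- The additive map of ring completions induced by an additive map. -/
noncomputable def K0.addMap (f : S →+ T) : K0 S →+ K0 T := K0.lift (K0.of.comp f)

lemma K0.addMap_of (f : S →+ T) (s : S) : K0.addMap f (K0.of s) = K0.of (f s) := K0.lift_of _ s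

/-- The ring homomorphism of ring completions induced by a homomorphism of semirings. -/
noncomputable def K0.map (f : S →+* T) : K0 S →+* K0 T where
  __ := K0.addMap f.toAddMonoidHom
  map_one' := (K0.addMap_of _ 1).trans (by simp [K0.of_one])
  map_mul' a b := by
    have : (AddMonoidHom.compr₂ K0.mulHom (K0.addMap f.toAddMonoidHom) : K0 S →+ K0 S →+ K0 T) =
        (K0.mulHom.compl₂ (K0.addMap f.toAddMonoidHom)).comp (K0.addMap f.toAddMonoidHom) :=
      K0.hom_ext₂ fun s t => by simp [K0.mulHom_of, K0.addMap_of]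
    exact DFunLike.congr_fun (DFunLike.congr_fun this a) b

/-- The ring completion `γS` of a family of semirings with structure maps: `f^*` and `f_+` are
extended additively, `f_•` is extended to the algebraic map which restricts to it. -/
noncomputable def TambaraData.completion {G : Type u} [Group G] (S : TambaraData.{u, w} G) :
    TambaraData.{u, w} G where
  obj X := K0 (S.obj X)
  res f := K0.map (S.res f)
  tr f := K0.addMap (S.tr f)
  nm f := algExt fun a => K0.of (S.nm f a)

end Grothendieck

/-! ### Canonical isomorphisms of `G`-sets -/

namespace FinGSet

variable {G : Type u} [Group G] {X Y A B C A' B' : FinGSet G}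

/-- `f ⨿ g`. -/
def sumMap (f : A →[G] A') (g : B →[G] B') : A.sum B →[G] A'.sum B' :=
  sumElim (comp (inl _ _) f) (comp (inr _ _) g)

lemma sumMap_bijective {f : A →[G] A'} {g : B →[G] B'} (hf : Bijective f) (hg : Bijective g) :
    Bijective (sumMap f g) := by
  have : (sumMap f g : A.sum B → A'.sum B') = Sum.map f g := by
    funext x; cases x <;> rfl
  rw [this]
  exact Sum.map_bijective.2 ⟨hf, hg⟩

/-- Associativity of the disjoint union. -/
def sumAssoc (A B C : FinGSet G) : (A.sum B).sum C →[G] A.sum (B.sum C) :=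
  sumElim (sumElim (inl _ _) (comp (inr _ _) (inl _ _))) (comp (inr _ _) (inr _ _))

lemma sumAssoc_bijective : Bijective (sumAssoc A B C) := by
  have : (sumAssoc A B C : (A.sum B).sum C → A.sum (B.sum C)) = Equiv.sumAssoc A B C := by
    funext x; rcases x with (x | x) | x <;> rfl
  rw [this]
  exact Equiv.bijective _

/-- Commutativity of the disjoint union. -/
def sumComm (A B : FinGSet G) : A.sum B →[G] B.sum A := sumElim (inr _ _) (inl _ _)

lemma sumComm_bijective : Bijective (sumComm A B) := by
  have : (sumComm A B : A.sum B → B.sum A) = Equiv.sumComm A B := by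
    funext x; rcases x with x | x <;> rfl
  rw [this]
  exact Equiv.bijective _

lemma inr_empty_bijective : Bijective (inr empty A) :=
  ⟨Sum.inr_injective, fun x => by
    rcases x with x | x
    · exact (isEmptyElim (α := (empty : FinGSet G)) x)
    · exact ⟨x, rfl⟩⟩

lemma isCoproduct_sum (A B : FinGSet G) : IsCoproduct (inl A B) (inr A B) := by
  have : Sum.elim (inl A B) (inr A B) = (id : A.sum B → A.sum B) := by
    funext x; cases x <;> rfl
  rw [IsCoproduct, this]
  exact bijective_id

lemma plift_bijective {p : A →[G] X} {q : B →[G] X} {a : C →[G] A} {b : C →[G] B}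
    {h : ∀ c, p (a c) = q (b c)} (h1 : ∀ c d, a c = a d → b c = b d → c = d)
    (h2 : ∀ x y, p x = q y → ∃ c, a c = x ∧ b c = y) : Bijective (plift p q a b h) := by
  refine ⟨fun c d hcd => h1 c d ?_ ?_, fun z => ?_⟩
  · exact congrArg (pfst p q) hcd
  · exact congrArg (psnd p q) hcd
  · obtain ⟨c, hc1, hc2⟩ := h2 _ _ z.2
    exact ⟨c, fiberProd_ext hc1 hc2⟩

/-- Functoriality of the fibre product. -/
def pmap {p : A →[G] X} {q : B →[G] X} {p' : A' →[G] X} {q' : B' →[G] X} (f : A →[G] A')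
    (g : B →[G] B') (hf : ∀ a, p' (f a) = p a) (hg : ∀ b, q' (g b) = q b) :
    fiberProd p q →[G] fiberProd p' q' :=
  plift p' q' (comp f (pfst p q)) (comp g (psnd p q))
    fun c => (hf _).trans (c.2.trans (hg _).symm)

lemma pmap_bijective {p : A →[G] X} {q : B →[G] X} {p' : A' →[G] X} {q' : B' →[G] X}
    {f : A →[G] A'} {g : B →[G] B'} {hf : ∀ a, p' (f a) = p a} {hg : ∀ b, q' (g b) = q b}
    (bf : Bijective f) (bg : Bijective g) : Bijective (pmap f g hf hg) := by
  refine plift_bijective (fun c d h1 h2 => fiberProd_ext (bf.1 h1) (bg.1 h2)) fun x y h => ?_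
  obtain ⟨a, rfl⟩ := bf.2 x
  obtain ⟨b, rfl⟩ := bg.2 y
  exact ⟨⟨(a, b), (hf a).symm.trans (h.trans (hg b))⟩, rfl, rfl⟩

/-- Commutativity of the fibre product. -/
def pswap (p : A →[G] X) (q : B →[G] X) : fiberProd p q →[G] fiberProd q p :=
  plift q p (psnd p q) (pfst p q) fun c => c.2.symm

lemma pswap_bijective {p : A →[G] X} {q : B →[G] X} : Bijective (pswap p q) :=
  plift_bijective (fun _ _ h1 h2 => fiberProd_ext h2 h1) fun x y h => ⟨⟨(y, x), h.symm⟩, rfl, rfl⟩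

/-- The structure map of the fibre product. -/
def pstr (p : A →[G] X) (q : B →[G] X) : fiberProd p q →[G] X := comp p (pfst p q)

/-- Associativity of the fibre product. -/
def passoc (p : A →[G] X) (q : B →[G] X) (r : C →[G] X) :
    fiberProd (pstr p q) r →[G] fiberProd p (pstr q r) :=
  plift _ _ (comp (pfst p q) (pfst _ _))
    (plift q r (comp (psnd p q) (pfst _ _)) (psnd _ _)
      fun c => (c.1.1.2.symm.trans c.2))
    fun c => c.1.1.2

lemma passoc_bijective {p : A →[G] X} {q : B →[G] X} {r : C →[G] X} :
    Bijective (passoc p q r) := by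
  refine plift_bijective (fun c d h1 h2 => ?_) fun x y h => ?_
  · exact fiberProd_ext (fiberProd_ext h1 (congrArg (pfst q r) h2)) (congrArg (psnd q r) h2)
  · exact ⟨⟨(⟨(x, y.1.1), h⟩, y.1.2), h.trans y.2⟩, rfl, rfl⟩

lemma psnd_idm_bijective {q : B →[G] X} : Bijective (psnd (idm X) q) :=
  ⟨fun c d h => fiberProd_ext (c.2.trans ((congrArg q h).trans d.2.symm)) h,
    fun b => ⟨⟨(q b, b), rfl⟩, rfl⟩⟩

/-- Distributivity. -/
def pdistrib (p : A →[G] X) (q : B →[G] X) (r : C →[G] X) :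
    (fiberProd p r).sum (fiberProd q r) →[G] fiberProd (sumElim p q) r :=
  sumElim (plift _ _ (comp (inl _ _) (pfst p r)) (psnd p r) fun c => c.2)
    (plift _ _ (comp (inr _ _) (pfst q r)) (psnd q r) fun c => c.2)

lemma pdistrib_bijective {p : A →[G] X} {q : B →[G] X} {r : C →[G] X} :
    Bijective (pdistrib p q r) := by
  constructor
  · have e1 : ∀ {c d}, pdistrib p q r c = pdistrib p q r d →
        pfst (sumElim p q) r (pdistrib p q r c) = pfst (sumElim p q) r (pdistrib p q r d) :=
      fun h => congrArg _ h
    have e2 : ∀ {c d}, pdistrib p q r c = pdistrib p q r d →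
        psnd (sumElim p q) r (pdistrib p q r c) = psnd (sumElim p q) r (pdistrib p q r d) :=
      fun h => congrArg _ h
    rintro (c | c) (d | d) h
    · exact congrArg Sum.inl (fiberProd_ext (Sum.inl_injective (e1 h)) (e2 h))
    · exact (Sum.inl_ne_inr (e1 h)).elim
    · exact (Sum.inr_ne_inl (e1 h)).elim
    · exact congrArg Sum.inr (fiberProd_ext (Sum.inr_injective (e1 h)) (e2 h))
  · rintro ⟨⟨a | b, c⟩, h⟩
    · exact ⟨Sum.inl ⟨(a, c), h⟩, rfl⟩
    · exact ⟨Sum.inr ⟨(b, c), h⟩, rfl⟩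

instance {p : A →[G] X} {q : B →[G] X} [IsEmpty A] : IsEmpty (fiberProd p q) :=
  ⟨fun c => isEmptyElim (pfst p q c)⟩

/-- Pulling back along `ζ` commutes with fibre products. -/
def pbase (p : A →[G] X) (q : B →[G] X) (ζ : Y →[G] X) :
    fiberProd (pstr p q) ζ →[G] fiberProd (psnd p ζ) (psnd q ζ) :=
  plift _ _ (plift p ζ (comp (pfst p q) (pfst _ _)) (psnd _ _) fun c => c.2)
    (plift q ζ (comp (psnd p q) (pfst _ _)) (psnd _ _) fun c => c.1.1.2.symm.trans c.2)
    fun _ => rfl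

lemma pbase_bijective {p : A →[G] X} {q : B →[G] X} {ζ : Y →[G] X} :
    Bijective (pbase p q ζ) := by
  refine plift_bijective (fun c d h1 h2 => ?_) fun x y h => ?_
  · have e1 := congrArg (pfst p ζ) h1
    have e2 := congrArg (pfst q ζ) h2
    have e3 := congrArg (psnd p ζ) h1
    exact fiberProd_ext (fiberProd_ext e1 e2) e3
  · refine ⟨⟨(⟨(x.1.1, y.1.1), x.2.trans ((congrArg ζ h).trans y.2.symm)⟩, x.1.2), x.2⟩, rfl, ?_⟩
    exact fiberProd_ext rfl h

/-- The map `Π_η(f)`. -/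
def dmap {η : X →[G] Y} {p : A →[G] X} {q : B →[G] X} (f : A →[G] B)
    (hf : ∀ a, q (f a) = p a) : dprod η p →[G] dprod η q where
  toFun s := ⟨s.1, fun x => f (s.2.1 x), fun x => (hf _).trans (s.2.2 x)⟩
  map_smul' g _ := SectionPair.ext rfl fun _ _ _ => map_smul f g _

lemma dmap_bijective {η : X →[G] Y} {p : A →[G] X} {q : B →[G] X} {f : A →[G] B}
    {hf : ∀ a, q (f a) = p a} (bf : Bijective f) : Bijective (dmap (η := η) f hf) := by
  constructor
  · rintro ⟨y, σ⟩ ⟨z, τ⟩ h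
    obtain rfl : y = z := congrArg (dproj η q) h
    refine congrArg (Sigma.mk y) (Subtype.ext (funext fun x => bf.1 ?_))
    have h' := eq_of_heq (Sigma.mk.inj h).2
    exact congrFun (congrArg Subtype.val h') x
  · rintro ⟨y, τ⟩
    choose σ hσ using fun x => bf.2 (τ.1 x)
    refine ⟨⟨y, σ, fun x => (hf _).symm.trans ((congrArg q (hσ x)).trans (τ.2 x))⟩, ?_⟩
    exact SectionPair.ext rfl fun x _ _ => hσ _

/-- The inverse of a bijective equivariant map. -/
noncomputable def inv (f : A →[G] B) (hf : Bijective f) : B →[G] A :=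
  f.inverse (Equiv.ofBijective f hf).symm (Equiv.ofBijective f hf).symm_apply_apply
    (Equiv.ofBijective f hf).apply_symm_apply

lemma inv_bijective {f : A →[G] B} (hf : Bijective f) : Bijective (inv f hf) :=
  (Equiv.ofBijective f hf).symm.bijective

lemma inv_comp {f : A →[G] B} (hf : Bijective f) : comp (inv f hf) f = idm A :=
  MulActionHom.ext (Equiv.ofBijective f hf).symm_apply_apply

lemma comp_inv {f : A →[G] B} (hf : Bijective f) : comp f (inv f hf) = idm B :=
  MulActionHom.ext (Equiv.ofBijective f hf).apply_symm_apply

end FinGSet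

/-! ### Tambarization of a semi-Mackey functor -/

section Tambarization

variable {G : Type u} [Group G]

namespace SemiMackeyFunctor

variable (M : SemiMackeyFunctor.{u, w} G) {A B X Y Z : FinGSet G}

lemma res_id (m : M.obj X) : M.res (idm X) m = m := M.isSemiMackey.res_id X m

lemma res_comp (g : Y →[G] Z) (f : X →[G] Y) (m : M.obj Z) :
    M.res (comp g f) m = M.res f (M.res g m) := M.isSemiMackey.res_comp g f m

lemma res_res {W : FinGSet G} {g : Y →[G] Z} {f : X →[G] Y} {g' : W →[G] Z} {f' : X →[G] W}
    (h : comp g f = comp g' f') (m : M.obj Z) :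
    M.res f (M.res g m) = M.res f' (M.res g' m) := by
  rw [← res_comp, ← res_comp, h]

lemma res_eq {g : Y →[G] Z} {f : X →[G] Y} {k : X →[G] Z}
    (h : comp g f = k) (m : M.obj Z) :
    M.res f (M.res g m) = M.res k m := by
  rw [← res_comp, h]

/-- The element `m ⨿ n` of `M(A ⨿ B)`, whose restrictions to `A` and `B` are `m` and `n`. -/
noncomputable def glue (m : M.obj A) (n : M.obj B) : M.obj (A.sum B) :=
  ((M.isSemiMackey.additive _ _ (isCoproduct_sum A B)).2 (m, n)).choose

@[simp]
lemma res_inl_glue (m : M.obj A) (n : M.obj B) : M.res (inl A B) (M.glue m n) = m :=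
  congrArg Prod.fst ((M.isSemiMackey.additive _ _ (isCoproduct_sum A B)).2 (m, n)).choose_spec

@[simp]
lemma res_inr_glue (m : M.obj A) (n : M.obj B) : M.res (inr A B) (M.glue m n) = n :=
  congrArg Prod.snd ((M.isSemiMackey.additive _ _ (isCoproduct_sum A B)).2 (m, n)).choose_spec

lemma sum_ext {m n : M.obj (A.sum B)} (h1 : M.res (inl A B) m = M.res (inl A B) n)
    (h2 : M.res (inr A B) m = M.res (inr A B) n) : m = n :=
  (M.isSemiMackey.additive _ _ (isCoproduct_sum A B)).1 (Prod.ext h1 h2)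

lemma res_sum {f : A.sum B →[G] Z} {f₁ : A →[G] Z} {f₂ : B →[G] Z} {m : M.obj Z}
    {n : M.obj A} {k : M.obj B} (h1 : comp f (inl A B) = f₁) (h2 : comp f (inr A B) = f₂)
    (e1 : M.res f₁ m = n) (e2 : M.res f₂ m = k) : M.res f m = M.glue n k :=
  M.sum_ext (by rw [M.res_eq h1, e1, res_inl_glue]) (by rw [M.res_eq h2, e2, res_inr_glue])

end SemiMackeyFunctor

/-- An object `(p : A → X, m)` with `m ∈ M(A)` of the category `M-Gset/X`. -/
structure MSet (M : SemiMackeyFunctor.{u, w} G) (X : FinGSet G) : Type (max (u + 1) w) where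
  A : FinGSet G
  p : A →[G] X
  m : M.obj A

namespace MSet

variable (M : SemiMackeyFunctor.{u, w} G) (X : FinGSet G)

/-- Isomorphism in `M-Gset/X`. -/
instance setoid : Setoid (MSet M X) where
  r a b := ∃ f : a.A →[G] b.A, Bijective f ∧ (∀ x, b.p (f x) = a.p x) ∧ M.res f b.m = a.m
  iseqv :=
    { refl := fun a => ⟨idm _, bijective_id, fun _ => rfl, M.res_id _⟩
      symm := by
        rintro a b ⟨f, hf, hp, hm⟩
        refine ⟨inv f hf, inv_bijective hf, fun x => ?_, ?_⟩
        · rw [← hp]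
          exact congrArg b.p (DFunLike.congr_fun (comp_inv hf) x)
        · rw [← hm, ← M.res_comp, comp_inv, M.res_id]
      trans := by
        rintro a b c ⟨f, hf, hp, hm⟩ ⟨g, hg, hq, hn⟩
        exact ⟨comp g f, hg.comp hf, fun x => (hq _).trans (hp _),
          by rw [M.res_comp, hn, hm]⟩ }

end MSet

/-- The set `S_M(X)` of isomorphism classes of objects of `M-Gset/X`. -/
def SM (M : SemiMackeyFunctor.{u, w} G) (X : FinGSet G) : Type (max (u + 1) w) :=
  Quotient (MSet.setoid M X)

namespace SM

variable {M : SemiMackeyFunctor.{u, w} G} {X Y : FinGSet G}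

/-- The class of `(p : A → X, m)`. -/
def mk {A : FinGSet G} (p : A →[G] X) (m : M.obj A) : SM M X := Quotient.mk _ ⟨A, p, m⟩

lemma sound {A B : FinGSet G} {p : A →[G] X} {q : B →[G] X} {m : M.obj A} {n : M.obj B}
    (f : A →[G] B) (hf : Bijective f) (hp : ∀ x, q (f x) = p x) (hm : M.res f n = m) :
    mk p m = mk q n :=
  Quotient.sound ⟨f, hf, hp, hm⟩

lemma ind {P : SM M X → Prop} (h : ∀ (A : FinGSet G) (p : A →[G] X) (m : M.obj A), P (mk p m))
    (a : SM M X) : P a :=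
  Quotient.ind (fun a => h a.A a.p a.m) a

/-- The sum `(A ⨿ B → X, m ⨿ n)`. -/
noncomputable instance : Add (SM M X) where
  add := Quotient.map₂ (fun a b => ⟨a.A.sum b.A, sumElim a.p b.p, M.glue a.m b.m⟩) (by
    rintro a a' ⟨f, hf, hp, hm⟩ b b' ⟨g, hg, hq, hn⟩
    refine ⟨sumMap f g, sumMap_bijective hf hg, ?_, ?_⟩
    · rintro (x | x)
      exacts [hp x, hq x]
    · refine M.res_sum (f₁ := comp (inl _ _) f) (f₂ := comp (inr _ _) g) rfl rfl ?_ ?_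
      · rw [M.res_comp, M.res_inl_glue, hm]
      · rw [M.res_comp, M.res_inr_glue, hn])

/-- The product `(A ×_X B → X, ϖ₁^*(m) · ϖ₂^*(n))`. -/
instance : Mul (SM M X) where
  mul := Quotient.map₂ (fun a b => ⟨fiberProd a.p b.p, pstr a.p b.p,
      M.res (pfst a.p b.p) a.m * M.res (psnd a.p b.p) b.m⟩) (by
    rintro a a' ⟨f, hf, hp, hm⟩ b b' ⟨g, hg, hq, hn⟩
    refine ⟨pmap f g hp hq, pmap_bijective hf hg, fun x => hp _, ?_⟩
    dsimp only
    rw [map_mul, ← hm, ← hn]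
    exact congrArg₂ _ (M.res_res (by rfl) _) (M.res_res (by rfl) _))

/-- The class of the empty set. -/
instance : Zero (SM M X) := ⟨mk (fromEmpty X) 1⟩

/-- The class of `(id : X → X, 1)`. -/
instance : One (SM M X) := ⟨mk (idm X) 1⟩

lemma mk_add {A B : FinGSet G} (p : A →[G] X) (q : B →[G] X) (m : M.obj A) (n : M.obj B) :
    mk p m + mk q n = mk (sumElim p q) (M.glue m n) := rfl

lemma mk_mul {A B : FinGSet G} (p : A →[G] X) (q : B →[G] X) (m : M.obj A) (n : M.obj B) :
    mk p m * mk q n = mk (pstr p q) (M.res (pfst p q) m * M.res (psnd p q) n) := rfl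

lemma mk_empty {A : FinGSet G} [h : IsEmpty A] (p : A →[G] X) (m : M.obj A) : mk p m = 0 :=
  haveI := M.isSemiMackey.subsingleton A h
  (sound (M := M) (p := fromEmpty X) (q := p) (fromEmpty A)
    ⟨fun x => isEmptyElim x, fun x => isEmptyElim x⟩ (fun x => isEmptyElim x)
    (haveI := M.isSemiMackey.subsingleton empty inferInstance; Subsingleton.elim _ _)).symm

lemma sm_add_comm (a b : SM M X) : a + b = b + a := by
  induction a using ind with | _ A p m
  induction b using ind with | _ B q n
  refine sound (sumComm A B) sumComm_bijective ?_ ?_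
  · rintro (x | x) <;> rfl
  · exact M.res_sum rfl rfl (M.res_inr_glue _ _) (M.res_inl_glue _ _)

lemma sm_add_assoc (a b c : SM M X) : a + b + c = a + (b + c) := by
  induction a using ind with | _ A p m
  induction b using ind with | _ B q n
  induction c using ind with | _ C r k
  refine sound (sumAssoc A B C) sumAssoc_bijective ?_ ?_
  · rintro ((x | x) | x) <;> rfl
  · refine M.res_sum rfl rfl (M.res_sum rfl rfl (M.res_inl_glue _ _) ?_) ?_
    · change M.res (comp (inr _ _) (inl _ _)) _ = _
      rw [M.res_comp, M.res_inr_glue, M.res_inl_glue]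
    · change M.res (comp (inr _ _) (inr _ _)) _ = _
      rw [M.res_comp, M.res_inr_glue, M.res_inr_glue]

lemma sm_zero_add (a : SM M X) : 0 + a = a := by
  induction a using ind with | _ A p m
  exact (sound (inr empty A) inr_empty_bijective (fun _ => rfl) (M.res_inr_glue _ _)).symm

lemma sm_mul_comm (a b : SM M X) : a * b = b * a := by
  induction a using ind with | _ A p m
  induction b using ind with | _ B q n
  refine sound (pswap p q) pswap_bijective (fun x => x.2.symm) ?_
  rw [map_mul, mul_comm]
  exact congrArg₂ _ (M.res_eq rfl _) (M.res_eq rfl _)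

lemma sm_mul_assoc (a b c : SM M X) : a * b * c = a * (b * c) := by
  induction a using ind with | _ A p m
  induction b using ind with | _ B q n
  induction c using ind with | _ C r k
  refine sound (passoc p q r) passoc_bijective (fun x => rfl) ?_
  simp only [map_mul, ← mul_assoc]
  refine congrArg₂ _ (congrArg₂ _ (M.res_res (by rfl) _) ?_) ?_
  · rw [← M.res_comp, ← M.res_comp, ← M.res_comp]; rfl
  · rw [← M.res_comp, ← M.res_comp]; rfl

lemma sm_one_mul (a : SM M X) : 1 * a = a := by
  induction a using ind with | _ A p m
  refine sound (psnd (idm X) p) psnd_idm_bijective (fun x => x.2.symm) ?_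
  rw [map_one, one_mul]

lemma sm_zero_mul (a : SM M X) : 0 * a = 0 := by
  induction a using ind with | _ A p m
  exact mk_empty (A := fiberProd (fromEmpty X) p) _ _

lemma sm_add_mul (a b c : SM M X) : (a + b) * c = a * c + b * c := by
  induction a using ind with | _ A p m
  induction b using ind with | _ B q n
  induction c using ind with | _ C r k
  refine (sound (pdistrib p q r) pdistrib_bijective ?_ ?_).symm
  · rintro (x | x) <;> rfl
  · refine M.res_sum rfl rfl ?_ ?_
    · rw [map_mul, ← M.res_comp, ← M.res_comp]
      refine congrArg₂ _ ?_ rfl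
      change M.res (comp (inl _ _) (pfst _ _)) _ = _
      rw [M.res_comp, M.res_inl_glue]
    · rw [map_mul, ← M.res_comp, ← M.res_comp]
      refine congrArg₂ _ ?_ rfl
      change M.res (comp (inr _ _) (pfst _ _)) _ = _
      rw [M.res_comp, M.res_inr_glue]

noncomputable instance : CommSemiring (SM M X) where
  add_assoc := sm_add_assoc
  zero_add := sm_zero_add
  add_zero a := (sm_add_comm _ _).trans (sm_zero_add a)
  add_comm := sm_add_comm
  nsmul := nsmulRec
  left_distrib a b c := by rw [sm_mul_comm, sm_add_mul, sm_mul_comm b, sm_mul_comm c]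
  right_distrib := sm_add_mul
  zero_mul := sm_zero_mul
  mul_zero a := (sm_mul_comm _ _).trans (sm_zero_mul a)
  mul_assoc := sm_mul_assoc
  one_mul := sm_one_mul
  mul_one a := (sm_mul_comm _ _).trans (sm_one_mul a)
  mul_comm := sm_mul_comm

/-- `ζ^*(p : A → X, m) = (A ×_X Y → Y, ζ'^*(m))`. -/
def resFun (ζ : Y →[G] X) : SM M X → SM M Y :=
  Quotient.map (fun a => ⟨fiberProd a.p ζ, psnd a.p ζ, M.res (pfst a.p ζ) a.m⟩) (by
    rintro a b ⟨f, hf, hp, hm⟩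
    refine ⟨pmap f (idm Y) hp (fun _ => rfl), pmap_bijective hf bijective_id, fun _ => rfl, ?_⟩
    dsimp only
    rw [← hm]
    exact M.res_res (by rfl) _)

/-- `ζ^*` as a homomorphism of semirings. -/
noncomputable def res (ζ : Y →[G] X) : SM M X →+* SM M Y where
  toFun := resFun ζ
  map_zero' := mk_empty (A := fiberProd (fromEmpty X) ζ) _ _
  map_one' := sound (psnd (idm X) ζ) psnd_idm_bijective (fun _ => rfl)
    ((map_one _).trans (map_one _).symm)
  map_add' a b := by
    induction a using ind with | _ A p m
    induction b using ind with | _ B q n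
    refine (sound (pdistrib p q ζ) pdistrib_bijective ?_ ?_).symm
    · rintro (x | x) <;> rfl
    · refine M.res_sum rfl rfl ?_ ?_
      · rw [← M.res_comp]
        change M.res (comp (inl _ _) (pfst _ _)) _ = _
        rw [M.res_comp, M.res_inl_glue]
      · rw [← M.res_comp]
        change M.res (comp (inr _ _) (pfst _ _)) _ = _
        rw [M.res_comp, M.res_inr_glue]
  map_mul' a b := by
    induction a using ind with | _ A p m
    induction b using ind with | _ B q n
    refine sound (pbase p q ζ) pbase_bijective (fun _ => rfl) ?_
    simp only [map_mul]
    refine congrArg₂ _ ?_ ?_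
    · simp only [← M.res_comp]; rfl
    · simp only [← M.res_comp]; rfl

/-- `ξ_+(p : A → X, m) = (ξ ∘ p : A → Y, m)`. -/
noncomputable def tr (ξ : X →[G] Y) : SM M X →+ SM M Y where
  toFun := Quotient.map (fun a => ⟨a.A, comp ξ a.p, a.m⟩) (by
    rintro a b ⟨f, hf, hp, hm⟩
    exact ⟨f, hf, fun x => congrArg ξ (hp x), hm⟩)
  map_zero' := mk_empty (A := empty) _ _
  map_add' a b := by
    induction a using ind with | _ A p m
    induction b using ind with | _ B q n
    refine sound (idm _) bijective_id ?_ (M.res_id _)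
    rintro (x | x) <;> rfl

/-- `η_•(p : A → X, m) = (π : Π_η(A) → Y, M_*(ρ)M^*(λ)(m))`. -/
def nm (η : X →[G] Y) : SM M X → SM M Y :=
  Quotient.map (fun a => ⟨dprod η a.p, dproj η a.p,
      M.tr (psnd η (dproj η a.p)) (M.res (deval η a.p) a.m)⟩) (by
    rintro a b ⟨f, hf, hp, hm⟩
    refine ⟨dmap f hp, dmap_bijective hf, fun _ => rfl, ?_⟩
    dsimp only
    let f' : fiberProd η (dproj η a.p) →[G] fiberProd η (dproj η b.p) :=
      pmap (idm X) (dmap f hp) (fun _ => rfl) (fun _ => rfl)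
    have h : IsPullback f' (psnd η (dproj η a.p)) (psnd η (dproj η b.p)) (dmap f hp) := by
      refine ⟨fun _ => rfl, fun x y hxy => ⟨⟨(x.1.1, y), ?_⟩, ⟨?_, rfl⟩, ?_⟩⟩
      · exact x.2.trans (congrArg (dproj η b.p) hxy)
      · exact fiberProd_ext rfl hxy.symm
      · rintro c ⟨rfl, rfl⟩
        rfl
    refine (M.isSemiMackey.mackey f' _ _ _ h _).trans (congrArg _ ?_)
    rw [← hm]
    exact M.res_res (by rfl) _)

end SM

/-- The semi-Tambara functor `S_M`. -/
noncomputable def semiTambarization (M : SemiMackeyFunctor.{u, w} G) :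
    TambaraData.{u, max (u + 1) w} G where
  obj X := SM M X
  res f := SM.res f
  tr f := SM.tr f
  nm f := SM.nm f

/-- The Tambarization `T_M = γ S_M`. -/
noncomputable def tambarization (M : SemiMackeyFunctor.{u, w} G) :
    TambaraData.{u, max (u + 1) w} G :=
  (semiTambarization M).completion

end Tambarization

/-! ### The fixed point functor -/

section FixedPoint

variable {G : Type u} [Group G] (Q : Type u) [CommMonoid Q] [MulDistribMulAction G Q]

instance {X : FinGSet G} : Mul (X →[G] Q) :=
  ⟨fun a b => ⟨fun x => a x * b x, fun g x => by simp [map_smul]⟩⟩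

instance {X : FinGSet G} : One (X →[G] Q) := ⟨⟨fun _ => 1, fun g _ => (smul_one g).symm⟩⟩

/-- Equivariant maps into a `G`-monoid form a monoid under pointwise multiplication. -/
instance {X : FinGSet G} : CommMonoid (X →[G] Q) where
  mul_assoc _ _ _ := MulActionHom.ext fun _ => mul_assoc _ _ _
  one_mul _ := MulActionHom.ext fun _ => one_mul _
  mul_one _ := MulActionHom.ext fun _ => mul_one _
  mul_comm _ _ := MulActionHom.ext fun _ => mul_comm _ _

variable {Q}

lemma finprod_fiber_smul {X Y : FinGSet G} (f : X →[G] Y) (y : Y) (g : G)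
    (β : {x : X // f x = y} → Q) (γ : {x : X // f x = g • y} → Q)
    (h : ∀ x hx hx', γ ⟨g • x, hx⟩ = g • β ⟨x, hx'⟩) :
    ∏ᶠ x, γ x = g • ∏ᶠ x, β x := by
  let e : {x : X // f x = y} ≃ {x : X // f x = g • y} :=
    (MulAction.toPerm g).subtypeEquiv fun x => by simp [map_smul]
  rw [← finprod_comp_equiv e]
  have := (MulDistribMulAction.toMonoidHom Q g).map_finprod (f := β) (Set.toFinite _)
  exact (finprod_congr fun (x : {x : X // f x = y}) => h x.1 _ x.2).trans this.symm

/-- `P_{Q*}(g)(α)(y) = ∏_{x ∈ g⁻¹(y)} α(x)`. -/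
noncomputable def fixedTr {X Y : FinGSet G} (g : X →[G] Y) : (X →[G] Q) →* (Y →[G] Q) where
  toFun α :=
    { toFun := fun y => ∏ᶠ x : {x : X // g x = y}, α x
      map_smul' := fun h y => finprod_fiber_smul g y h (fun x => α x) (fun x => α x)
        fun x _ _ => map_smul α h x }
  map_one' := MulActionHom.ext fun _ => finprod_one
  map_mul' _ _ := MulActionHom.ext fun _ => finprod_mul_distrib (Set.toFinite _) (Set.toFinite _)

lemma fixedTr_apply {X Y : FinGSet G} (g : X →[G] Y) (α : X →[G] Q) (y : Y) :
    fixedTr g α y = ∏ᶠ x : {x : X // g x = y}, α x := rfl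

/-- `P_Q^*(f)(α) = α ∘ f`. -/
def fixedRes {X Y : FinGSet G} (f : X →[G] Y) : (Y →[G] Q) →* (X →[G] Q) where
  toFun α := α.comp f
  map_one' := rfl
  map_mul' _ _ := rfl

lemma fixedTr_comp {X Y Z : FinGSet G} (g : Y →[G] Z) (f : X →[G] Y) (α : X →[G] Q) :
    fixedTr (comp g f) α = fixedTr g (fixedTr f α) := by
  ext z
  have := Fintype.ofFinite X
  have := Fintype.ofFinite Y
  classical
  simp only [fixedTr_apply, finprod_eq_prod_of_fintype]
  rw [← Fintype.prod_sigma']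
  exact Fintype.prod_equiv
    { toFun := fun x => ⟨⟨f x.1, x.2⟩, ⟨x.1, rfl⟩⟩
      invFun := fun s => ⟨s.2.1, (congrArg g s.2.2).trans s.1.2⟩
      left_inv := fun _ => rfl
      right_inv := by
        rintro ⟨⟨y, hy⟩, ⟨x, hx⟩⟩
        obtain rfl : f x = y := hx
        rfl } _ _ fun _ => rfl

lemma fixedTr_mackey {X' X Y' Y : FinGSet G} (f' : X' →[G] X) (g' : X' →[G] Y')
    (g : X →[G] Y) (f : Y' →[G] Y) (h : IsPullback f' g' g f) (α : X →[G] Q) :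
    fixedRes f (fixedTr g α) = fixedTr g' (fixedRes f' α) := by
  ext y
  let k : {x : X' // g' x = y} → {x : X // g x = f y} :=
    fun x => ⟨f' x.1, (h.1 x.1).trans (congrArg f x.2)⟩
  refine (finprod_eq_of_bijective (f := fun x : {x : X' // g' x = y} => α (f' x))
    (g := fun x : {x : X // g x = f y} => α x) k ⟨?_, ?_⟩ fun _ => rfl).symm
  · rintro ⟨a, ha⟩ ⟨b, hb⟩ hab
    have hab : f' a = f' b := congrArg Subtype.val hab
    obtain ⟨c, -, hc⟩ := h.2 (f' a) y ((h.1 a).trans (congrArg f ha))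
    exact Subtype.ext ((hc a ⟨rfl, ha⟩).trans (hc b ⟨hab.symm, hb⟩).symm)
  · rintro ⟨x, hx⟩
    obtain ⟨a, ⟨ha, hy⟩, -⟩ := h.2 x y hx
    exact ⟨⟨a, hy⟩, Subtype.ext ha⟩

variable (G Q)

/-- The fixed point functor `P_Q` of a `G`-monoid `Q`. -/
noncomputable def fixedPointFunctor : SemiMackeyFunctor.{u, u} G where
  obj X := X →[G] Q
  res f := fixedRes f
  tr g := fixedTr g
  isSemiMackey :=
    { res_id := fun _ _ => rfl
      res_comp := fun _ _ _ => rfl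
      tr_id := fun X α => MulActionHom.ext fun y => by
        rw [fixedTr_apply]
        have : Unique {x : X // idm X x = y} := ⟨⟨⟨y, rfl⟩⟩, fun x => Subtype.ext x.2⟩
        exact (finprod_unique _).trans (congrArg α (this.default.2))
      tr_comp := fixedTr_comp
      mackey := fixedTr_mackey
      subsingleton := fun X h => ⟨fun a b => MulActionHom.ext fun x => (h.false x).elim⟩
      additive := fun {X Y Z} i j h => by
        constructor
        · intro α β hαβ
          ext z
          obtain ⟨x | y, rfl⟩ := h.2 z
          · exact DFunLike.congr_fun (congrArg Prod.fst hαβ) x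
          · exact DFunLike.congr_fun (congrArg Prod.snd hαβ) y
        · rintro ⟨α, β⟩
          let e : X ⊕ Y ≃ Z := Equiv.ofBijective _ h
          have hl : ∀ x, e.symm (i x) = Sum.inl x := fun x => e.symm_apply_apply (Sum.inl x)
          have hr : ∀ y, e.symm (j y) = Sum.inr y := fun y => e.symm_apply_apply (Sum.inr y)
          refine ⟨⟨fun z => Sum.elim α β (e.symm z), fun g z => ?_⟩, Prod.ext ?_ ?_⟩
          · obtain ⟨x | y, rfl⟩ := h.2 z
            · change Sum.elim α β (e.symm (g • i x)) = g • Sum.elim α β (e.symm (i x))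
              rw [← map_smul, hl, hl]
              exact map_smul α g x
            · change Sum.elim α β (e.symm (g • j y)) = g • Sum.elim α β (e.symm (j y))
              rw [← map_smul, hr, hr]
              exact map_smul β g y
          · exact MulActionHom.ext fun x => congrArg (Sum.elim α β) (hl x)
          · exact MulActionHom.ext fun y => congrArg (Sum.elim α β) (hr y) }

end FixedPoint

/-! ### The Burnside group and its multiplicative transfers -/

section Burnside

open Algebra

variable {G : Type u} [Group G]

/-- A finite `G`-set over `W`. -/
structure GSetOver (W : FinGSet G) : Type (u + 1) where
  A : FinGSet G
  p : A →[G] W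

/-- Isomorphism of `G`-sets over `W`. -/
instance GSetOver.setoid (W : FinGSet G) : Setoid (GSetOver W) where
  r a b := ∃ f : a.A →[G] b.A, Bijective f ∧ ∀ x, b.p (f x) = a.p x
  iseqv :=
    { refl := fun a => ⟨idm _, bijective_id, fun _ => rfl⟩
      symm := by
        rintro a b ⟨f, hf, hp⟩
        refine ⟨inv f hf, inv_bijective hf, fun x => ?_⟩
        rw [← hp]
        exact congrArg b.p (DFunLike.congr_fun (comp_inv hf) x)
      trans := by
        rintro a b c ⟨f, hf, hp⟩ ⟨g, hg, hq⟩
        exact ⟨comp g f, hg.comp hf, fun x => (hq _).trans (hp _)⟩ }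

/-- Isomorphism classes of finite `G`-sets over `W`. -/
def OverClass (W : FinGSet G) : Type (u + 1) := Quotient (GSetOver.setoid W)

namespace OverClass

variable {V W : FinGSet G}

/-- The class of `p : A → W`. -/
def mk {A : FinGSet G} (p : A →[G] W) : OverClass W := Quotient.mk _ ⟨A, p⟩

lemma sound {A B : FinGSet G} {p : A →[G] W} {q : B →[G] W} (f : A →[G] B) (hf : Bijective f)
    (hp : ∀ x, q (f x) = p x) : mk p = mk q := Quotient.sound ⟨f, hf, hp⟩

lemma ind {P : OverClass W → Prop} (h : ∀ (A : FinGSet G) (p : A →[G] W), P (mk p))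
    (a : OverClass W) : P a :=
  Quotient.ind (fun a => h a.A a.p) a

/-- Disjoint union. -/
instance : Add (OverClass W) where
  add := Quotient.map₂ (fun a b => ⟨a.A.sum b.A, sumElim a.p b.p⟩) (by
    rintro a a' ⟨f, hf, hp⟩ b b' ⟨g, hg, hq⟩
    refine ⟨sumMap f g, sumMap_bijective hf hg, ?_⟩
    rintro (x | x)
    exacts [hp x, hq x])

instance : Zero (OverClass W) := ⟨mk (fromEmpty W)⟩

lemma over_add_comm (a b : OverClass W) : a + b = b + a := by
  induction a using ind with | _ A p
  induction b using ind with | _ B q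
  refine sound (sumComm A B) sumComm_bijective ?_
  rintro (x | x) <;> rfl

lemma over_add_assoc (a b c : OverClass W) : a + b + c = a + (b + c) := by
  induction a using ind with | _ A p
  induction b using ind with | _ B q
  induction c using ind with | _ C r
  refine sound (sumAssoc A B C) sumAssoc_bijective ?_
  rintro ((x | x) | x) <;> rfl

lemma over_zero_add (a : OverClass W) : 0 + a = a := by
  induction a using ind with | _ A p
  exact (sound (inr empty A) inr_empty_bijective fun _ => rfl).symm

instance : AddCommMonoid (OverClass W) where
  add_assoc := over_add_assoc
  zero_add := over_zero_add
  add_zero a := (over_add_comm _ _).trans (over_zero_add a)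
  add_comm := over_add_comm
  nsmul := nsmulRec

/-- Pull-back along `e : V → W`. -/
def res (e : V →[G] W) : OverClass W →+ OverClass V where
  toFun := Quotient.map (fun a => ⟨fiberProd a.p e, psnd a.p e⟩) (by
    rintro a b ⟨f, hf, hp⟩
    exact ⟨pmap f (idm V) hp (fun _ => rfl), pmap_bijective hf bijective_id, fun _ => rfl⟩)
  map_zero' := (sound (fromEmpty (fiberProd (fromEmpty W) e))
    ⟨fun x => isEmptyElim x, fun x => isEmptyElim (pfst (fromEmpty W) e x)⟩
    fun x => isEmptyElim x).symm
  map_add' a b := by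
    induction a using ind with | _ A p
    induction b using ind with | _ B q
    refine (sound (pdistrib p q e) pdistrib_bijective ?_).symm
    rintro (x | x) <;> rfl

/-- Composition with `f : V → W`. -/
def tr (f : V →[G] W) : OverClass V →+ OverClass W where
  toFun := Quotient.map (fun a => ⟨a.A, comp f a.p⟩) (by
    rintro a b ⟨h, hh, hp⟩
    exact ⟨h, hh, fun x => congrArg f (hp x)⟩)
  map_zero' := sound (idm _) bijective_id fun x => isEmptyElim x
  map_add' a b := by
    induction a using ind with | _ A p
    induction b using ind with | _ B q
    refine sound (idm _) bijective_id ?_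
    rintro (x | x) <;> rfl

/-- `S ↦ Π_f(S)`. -/
def nm (f : V →[G] W) : OverClass V → OverClass W :=
  Quotient.map (fun a => ⟨dprod f a.p, dproj f a.p⟩) (by
    rintro a b ⟨h, hh, hp⟩
    exact ⟨dmap h hp, dmap_bijective hh, fun _ => rfl⟩)

end OverClass

/-- The Burnside group `Ω(W)`. -/
abbrev Burnside (W : FinGSet G) : Type (u + 1) := GrothendieckAddGroup (OverClass W)

/-- The multiplicative transfer `Ω(V) → Ω(W)` of the Burnside ring functor: the algebraic map with
`[S] ↦ [Π_f(S)]`. -/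
noncomputable def burnsideNm {V W : FinGSet G} (f : V →[G] W) : Burnside V → Burnside W :=
  algExt fun a => GrothendieckAddGroup.of (OverClass.nm f a)

end Burnside

/-! ### The crossed Burnside ring functor -/

section Crossed

open Algebra

variable {G : Type u} [Group G] (Q : Type u) [CommMonoid Q] [MulDistribMulAction G Q]

/-- A crossed `G`-set `(p : A → X, m : A → Q)` over `X`. -/
structure CrossedSet (X : FinGSet G) : Type (u + 1) where
  A : FinGSet G
  p : A →[G] X
  m : A →[G] Q

/-- Isomorphism of crossed `G`-sets. -/
instance CrossedSet.setoid (X : FinGSet G) : Setoid (CrossedSet Q X) where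
  r a b := ∃ f : a.A →[G] b.A, Bijective f ∧ (∀ x, b.p (f x) = a.p x) ∧ ∀ x, b.m (f x) = a.m x
  iseqv :=
    { refl := fun a => ⟨idm _, bijective_id, fun _ => rfl, fun _ => rfl⟩
      symm := by
        rintro a b ⟨f, hf, hp, hm⟩
        refine ⟨inv f hf, inv_bijective hf, fun x => ?_, fun x => ?_⟩
        · rw [← hp]
          exact congrArg b.p (DFunLike.congr_fun (comp_inv hf) x)
        · rw [← hm]
          exact congrArg b.m (DFunLike.congr_fun (comp_inv hf) x)
      trans := by
        rintro a b c ⟨f, hf, hp, hm⟩ ⟨g, hg, hq, hn⟩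
        exact ⟨comp g f, hg.comp hf, fun x => (hq _).trans (hp _),
          fun x => (hn _).trans (hm _)⟩ }

/-- Isomorphism classes of crossed `G`-sets over `X`. -/
def CrossedClass (X : FinGSet G) : Type (u + 1) := Quotient (CrossedSet.setoid Q X)

namespace CrossedClass

variable {Q} {X Y : FinGSet G}

/-- The class of `(p : A → X, m)`. -/
def mk {A : FinGSet G} (p : A →[G] X) (m : A →[G] Q) : CrossedClass Q X :=
  Quotient.mk _ ⟨A, p, m⟩

lemma sound {A B : FinGSet G} {p : A →[G] X} {q : B →[G] X} {m : A →[G] Q} {n : B →[G] Q}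
    (f : A →[G] B) (hf : Bijective f) (hp : ∀ x, q (f x) = p x) (hm : ∀ x, n (f x) = m x) :
    mk p m = mk q n := Quotient.sound ⟨f, hf, hp, hm⟩

lemma ind {P : CrossedClass Q X → Prop}
    (h : ∀ (A : FinGSet G) (p : A →[G] X) (m : A →[G] Q), P (mk p m))
    (a : CrossedClass Q X) : P a :=
  Quotient.ind (fun a => h a.A a.p a.m) a

/-- `m ∪ n : A ⨿ B → Q`. -/
def union {A B : FinGSet G} (m : A →[G] Q) (n : B →[G] Q) : A.sum B →[G] Q where
  toFun := Sum.elim m n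
  map_smul' g x := by cases x <;> exact map_smul _ _ _

/-- `m * n : A ×_X B → Q`, `(a, b) ↦ m(a) n(b)`. -/
def star {A B : FinGSet G} (p : A →[G] X) (q : B →[G] X) (m : A →[G] Q) (n : B →[G] Q) :
    fiberProd p q →[G] Q where
  toFun c := m c.1.1 * n c.1.2
  map_smul' g c := by
    rw [smul_mul', ← map_smul, ← map_smul]; rfl

/-- The sum `(A ⨿ B → X, m ∪ n)`. -/
instance : Add (CrossedClass Q X) where
  add := Quotient.map₂ (fun a b => ⟨a.A.sum b.A, sumElim a.p b.p, union a.m b.m⟩) (by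
    rintro a a' ⟨f, hf, hp, hm⟩ b b' ⟨g, hg, hq, hn⟩
    refine ⟨sumMap f g, sumMap_bijective hf hg, ?_, ?_⟩
    · rintro (x | x)
      exacts [hp x, hq x]
    · rintro (x | x)
      exacts [hm x, hn x])

/-- The product `(A ×_X B → X, m * n)`. -/
instance : Mul (CrossedClass Q X) where
  mul := Quotient.map₂ (fun a b => ⟨fiberProd a.p b.p, pstr a.p b.p, star a.p b.p a.m b.m⟩) (by
    rintro a a' ⟨f, hf, hp, hm⟩ b b' ⟨g, hg, hq, hn⟩
    exact ⟨pmap f g hp hq, pmap_bijective hf hg, fun x => hp _,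
      fun x => congrArg₂ _ (hm _) (hn _)⟩)

/-- The class of the empty set. -/
instance : Zero (CrossedClass Q X) := ⟨mk (fromEmpty X) 1⟩

/-- The class of `(id : X → X, 1)`. -/
instance : One (CrossedClass Q X) := ⟨mk (idm X) 1⟩

lemma mk_empty {A : FinGSet G} [IsEmpty A] (p : A →[G] X) (m : A →[G] Q) : mk p m = 0 :=
  (sound (p := fromEmpty X) (m := 1) (fromEmpty A)
    ⟨fun x => isEmptyElim x, fun x => isEmptyElim x⟩ (fun x => isEmptyElim x)
    (fun x => isEmptyElim x)).symm

lemma cr_add_comm (a b : CrossedClass Q X) : a + b = b + a := by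
  induction a using ind with | _ A p m
  induction b using ind with | _ B q n
  refine sound (sumComm A B) sumComm_bijective ?_ ?_ <;> rintro (x | x) <;> rfl

lemma cr_add_assoc (a b c : CrossedClass Q X) : a + b + c = a + (b + c) := by
  induction a using ind with | _ A p m
  induction b using ind with | _ B q n
  induction c using ind with | _ C r k
  refine sound (sumAssoc A B C) sumAssoc_bijective ?_ ?_ <;> rintro ((x | x) | x) <;> rfl

lemma cr_zero_add (a : CrossedClass Q X) : 0 + a = a := by
  induction a using ind with | _ A p m
  exact (sound (inr empty A) inr_empty_bijective (fun _ => rfl) fun _ => rfl).symm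

lemma cr_mul_comm (a b : CrossedClass Q X) : a * b = b * a := by
  induction a using ind with | _ A p m
  induction b using ind with | _ B q n
  exact sound (pswap p q) pswap_bijective (fun x => x.2.symm) fun x => mul_comm _ _

lemma cr_mul_assoc (a b c : CrossedClass Q X) : a * b * c = a * (b * c) := by
  induction a using ind with | _ A p m
  induction b using ind with | _ B q n
  induction c using ind with | _ C r k
  exact sound (passoc p q r) passoc_bijective (fun x => rfl) fun x => (mul_assoc _ _ _).symm

lemma cr_one_mul (a : CrossedClass Q X) : 1 * a = a := by
  induction a using ind with | _ A p m
  exact sound (psnd (idm X) p) psnd_idm_bijective (fun x => x.2.symm) fun x => (one_mul _).symm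

lemma cr_zero_mul (a : CrossedClass Q X) : 0 * a = 0 := by
  induction a using ind with | _ A p m
  exact mk_empty (A := fiberProd (fromEmpty X) p) _ _

lemma cr_add_mul (a b c : CrossedClass Q X) : (a + b) * c = a * c + b * c := by
  induction a using ind with | _ A p m
  induction b using ind with | _ B q n
  induction c using ind with | _ C r k
  refine (sound (pdistrib p q r) pdistrib_bijective ?_ ?_).symm <;> rintro (x | x) <;> rfl

instance : CommSemiring (CrossedClass Q X) where
  add_assoc := cr_add_assoc
  zero_add := cr_zero_add
  add_zero a := (cr_add_comm _ _).trans (cr_zero_add a)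
  add_comm := cr_add_comm
  nsmul := nsmulRec
  left_distrib a b c := by rw [cr_mul_comm, cr_add_mul, cr_mul_comm b, cr_mul_comm c]
  right_distrib := cr_add_mul
  zero_mul := cr_zero_mul
  mul_zero a := (cr_mul_comm _ _).trans (cr_zero_mul a)
  mul_assoc := cr_mul_assoc
  one_mul := cr_one_mul
  mul_one a := (cr_mul_comm _ _).trans (cr_one_mul a)
  mul_comm := cr_mul_comm

/-- `f^*(q : B → Y, m) = (B ×_Y X → X, m ∘ f')`. -/
def res (f : X →[G] Y) : CrossedClass Q Y →+* CrossedClass Q X where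
  toFun := Quotient.map (fun b => ⟨fiberProd b.p f, psnd b.p f, b.m.comp (pfst b.p f)⟩) (by
    rintro a b ⟨h, hh, hp, hm⟩
    exact ⟨pmap h (idm X) hp (fun _ => rfl), pmap_bijective hh bijective_id, fun _ => rfl,
      fun x => hm _⟩)
  map_zero' := mk_empty (A := fiberProd (fromEmpty Y) f) _ _
  map_one' := sound (psnd (idm Y) f) psnd_idm_bijective (fun _ => rfl) fun _ => rfl
  map_add' a b := by
    induction a using ind with | _ A p m
    induction b using ind with | _ B q n
    refine (sound (pdistrib p q f) pdistrib_bijective ?_ ?_).symm <;> rintro (x | x) <;> rfl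
  map_mul' a b := by
    induction a using ind with | _ A p m
    induction b using ind with | _ B q n
    exact sound (pbase p q f) pbase_bijective (fun _ => rfl) fun _ => rfl

/-- `f_+(p : A → X, m) = (f ∘ p : A → Y, m)`. -/
def tr (f : X →[G] Y) : CrossedClass Q X →+ CrossedClass Q Y where
  toFun := Quotient.map (fun a => ⟨a.A, comp f a.p, a.m⟩) (by
    rintro a b ⟨h, hh, hp, hm⟩
    exact ⟨h, hh, fun x => congrArg f (hp x), hm⟩)
  map_zero' := mk_empty (A := empty) _ _
  map_add' a b := by
    induction a using ind with | _ A p m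
    induction b using ind with | _ B q n
    refine sound (idm _) bijective_id ?_ ?_ <;> rintro (x | x) <;> rfl

end CrossedClass

variable [Finite Q]

variable (G) in
/-- The finite `G`-monoid `Q` as a finite `G`-set. -/
abbrev monoidSet : FinGSet G where
  carrier := Q

/-- The additive isomorphism taking `(p : A → X, m)` to `(p, m) : A → X × Q`. -/
def CrossedClass.equivOver (X : FinGSet G) :
    CrossedClass Q X ≃+ OverClass (X.prod (monoidSet G Q)) where
  toFun := Quotient.map (fun a => ⟨a.A, pair a.p (Y := monoidSet G Q) a.m⟩) (by
    rintro a b ⟨f, hf, hp, hm⟩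
    exact ⟨f, hf, fun x => Prod.ext (hp x) (hm x)⟩)
  invFun := Quotient.map (fun a => ⟨a.A, comp (fst _ _) a.p, comp (snd _ _) a.p⟩) (by
    rintro a b ⟨f, hf, hp⟩
    exact ⟨f, hf, fun x => congrArg Prod.fst (hp x), fun x => congrArg Prod.snd (hp x)⟩)
  left_inv a := by
    induction a using CrossedClass.ind with | _ A p m
    rfl
  right_inv a := by
    induction a using OverClass.ind with | _ A p
    rfl
  map_add' a b := by
    induction a using CrossedClass.ind with | _ A p m
    induction b using CrossedClass.ind with | _ B q n
    refine OverClass.sound (idm _) bijective_id ?_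
    rintro (x | x) <;> rfl

/-- The map `μ_f : Π_f(X × Q) → Y × Q`, `(y, σ) ↦ (y, ∏_{x ∈ f⁻¹(y)} σ(x))`. -/
noncomputable def muMap {X Y : FinGSet G} (f : X →[G] Y) :
    dprod f (fst X (monoidSet G Q)) →[G] Y.prod (monoidSet G Q) where
  toFun s := (s.1, ∏ᶠ x : {x : X // f x = s.1}, (s.2.1 x).2)
  map_smul' g s := Prod.ext rfl (finprod_fiber_smul f s.1 g (fun x => (s.2.1 x).2)
    (fun x => ((g • s).2.1 x).2) fun x _ _ => congrArg (fun z : X × Q => g • z.2)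
      (SectionPair.congr s (inv_smul_smul g x) _ _))

/-- The multiplicative transfer `f_• : Ω_Q(X) → Ω_Q(Y)`, the composite
`Ω_Q(X) ≅ Ω(X × Q) → Ω(X ×_Y Π_f(X × Q)) → Ω(Π_f(X × Q)) → Ω(Y × Q) ≅ Ω_Q(Y)` of `e^*`, `f'_•`
and `(μ_f)_+`. -/
noncomputable def crossedNm {X Y : FinGSet G} (f : X →[G] Y) (a : K0 (CrossedClass Q X)) :
    K0 (CrossedClass Q Y) :=
  let pX := fst X (monoidSet G Q)
  let a₁ : Burnside (X.prod (monoidSet G Q)) :=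
    groupMap (CrossedClass.equivOver Q X).toAddMonoidHom a
  let a₂ : Burnside (fiberProd f (dproj f pX)) := groupMap (OverClass.res (deval f pX)) a₁
  let a₃ : Burnside (dprod f pX) := burnsideNm (psnd f (dproj f pX)) a₂
  let a₄ : Burnside (Y.prod (monoidSet G Q)) := groupMap (OverClass.tr (muMap Q f)) a₃
  groupMap (CrossedClass.equivOver Q Y).symm.toAddMonoidHom a₄

variable (G) in
/-- The crossed Burnside ring functor `Ω_Q`, with `Ω_Q(X)` the Grothendieck ring of crossed
`G`-sets over `X`. -/
noncomputable def crossedBurnside : TambaraData.{u, u + 1} G where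
  obj X := K0 (CrossedClass Q X)
  res f := K0.map (CrossedClass.res f)
  tr f := K0.addMap (CrossedClass.tr f)
  nm f := crossedNm Q f

end Crossed

end CrossedBurnside

open CrossedBurnside

namespace CrossedBurnside

open Function (Bijective bijective_id)
open FinGSet

/-! ### Algebraic maps -/

section AlgebraicMaps

open Algebra

variable {M M' N N' : Type*} [AddCommMonoid M] [AddCommMonoid M'] [AddCommGroup N]
  [AddCommGroup N']

namespace DegreeLT

/-! Before group completion there is almost nothing to compare. An element of `P_Q(A)` is an
equivariant labelling `A → Q`, so the semiring `S_M(X)` for `M = P_Q` is the semiring of crossed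
`G`-sets over `X` (`smEquiv`), and its multiplicative transfer becomes `(A, m) ↦ (Π_f(A), σ ↦ ∏
m(σ(x)))`, which is `CrossedClass.nm`. The multiplicative and exponential axioms for it are
statements about sections (pairs of sections, sections of sections, restriction to a pull-back,
distributivity) together with identities for products over fibres; most are reduced to one
recognition criterion for dependent products, `nm_mk_eq`.

Passing to rings uses the theory of algebraic maps. A map of degree `< n` on `M` is a linear map on
`ℤ[M]/I^n`, with `I` the augmentation ideal. In this ring every `[a]` is `1` plus a nilpotent
element, hence a unit, so `a ↦ [a]` extends to the Grothendieck group; this gives extensions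
(`IsAlgebraicMap.exists_extension`). They are unique by induction on the degree. The same
description shows that composites of algebraic maps are algebraic. Identities between algebraic maps
can therefore be checked on classes of actual objects (`K0.alg_ext`), and the completion of a
semi-Tambara functor is a Tambara functor once its multiplicative transfers are algebraic.

Algebraicity of `A ↦ Π_f(A)` is a count: its `j`-fold difference in the directions `B₁, …, B_j` is
the set of sections of `A ⨿ B₁ ⨿ ⋯ ⨿ B_j` which meet every `B_i`, and this is empty when `j` exceeds
the size of all fibres of `f` (`OverClass.nm_isAlgebraicMap`).

Finally, the composite defining `f_•` on `Ω_Q` agrees with `CrossedClass.nm` on crossed sets, by the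
exponential formula for the projection `X × Q → X` (`nm_eq_equivOver_symm`). Being algebraic, it is
the extension of `CrossedClass.nm`, so `Ω_Q` is the completion of crossed sets, and `smEquiv`
induces the isomorphism. -/

lemma zero (n : ℕ) : DegreeLT n (fun _ : M => (0 : N)) := by
  induction n with
  | zero => exact fun _ => rfl
  | succ n ih =>
    intro a
    have : fwdDiff a (fun _ : M => (0 : N)) = fun _ => 0 := funext fun _ => sub_self _
    rwa [this]

lemma const (c : N) : DegreeLT 1 (fun _ : M => c) := fun _ _ => sub_self _

lemma succ {n : ℕ} {φ : M → N} (h : DegreeLT n φ) : DegreeLT (n + 1) φ := by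
  induction n generalizing φ with
  | zero =>
    obtain rfl : φ = fun _ => 0 := funext h
    exact zero 1
  | succ n ih => exact fun a => ih (h a)

lemma mono {n m : ℕ} (hnm : n ≤ m) {φ : M → N} (h : DegreeLT n φ) : DegreeLT m φ := by
  induction hnm with
  | refl => exact h
  | step _ ih => exact ih.succ

lemma add {n : ℕ} {φ ψ : M → N} (h : DegreeLT n φ) (h' : DegreeLT n ψ) :
    DegreeLT n (fun x => φ x + ψ x) := by
  induction n generalizing φ ψ with
  | zero => exact fun x => (congrArg₂ (· + ·) (h x) (h' x)).trans (add_zero 0)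
  | succ n ih =>
    intro a
    have : fwdDiff a (fun x => φ x + ψ x) = fun x => fwdDiff a φ x + fwdDiff a ψ x :=
      funext fun x => by simp only [fwdDiff]; abel
    rw [this]
    exact ih (h a) (h' a)

lemma addHom_comp {n : ℕ} {φ : M → N} (h : DegreeLT n φ) (g : N →+ N') :
    DegreeLT n (fun x => g (φ x)) := by
  induction n generalizing φ with
  | zero => exact fun x => (congrArg g (h x)).trans (map_zero g)
  | succ n ih =>
    intro a
    have : fwdDiff a (fun x => g (φ x)) = fun x => g (fwdDiff a φ x) :=
      funext fun x => (map_sub g _ _).symm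
    rw [this]
    exact ih (h a)

lemma comp_addHom {n : ℕ} {φ : M → N} (h : DegreeLT n φ) (f : M' →+ M) :
    DegreeLT n (fun x => φ (f x)) := by
  induction n generalizing φ with
  | zero => exact fun x => h _
  | succ n ih =>
    intro a
    have : fwdDiff a (fun x => φ (f x)) = fun x => fwdDiff (f a) φ (f x) :=
      funext fun x => by simp only [fwdDiff, map_add]
    rw [this]
    exact ih (h _)

lemma translate {n : ℕ} {φ : M → N} (h : DegreeLT n φ) (c : M) :
    DegreeLT n (fun x => φ (x + c)) := by
  induction n generalizing φ with
  | zero => exact fun x => h _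
  | succ n ih =>
    intro a
    have : fwdDiff a (fun x => φ (x + c)) = fun x => fwdDiff a φ (x + c) :=
      funext fun x => by simp only [fwdDiff, add_right_comm]
    rw [this]
    exact ih (h _)

end DegreeLT

/-- The additive extension of `φ : M → N` to the monoid ring `ℤ[M]`. -/
noncomputable def linearization {M : Type*} (φ : M → N) : AddMonoidAlgebra ℤ M →+ N :=
  (Finsupp.liftAddHom fun a => (zmultiplesHom N (φ a))).comp
    AddMonoidAlgebra.coeffAddEquiv.toAddMonoidHom

lemma linearization_single {M : Type*} (φ : M → N) (a : M) (n : ℤ) :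
    linearization φ (AddMonoidAlgebra.single a n) = n • φ a :=
  (Finsupp.liftAddHom_apply_single (M := ℤ) (fun a => (zmultiplesHom N (φ a))) a n)

/-- The ideal of the monoid ring generated by the differences `[a] - 1`. -/
noncomputable def augmentationIdeal (M : Type*) [AddCommMonoid M] :
    Ideal (AddMonoidAlgebra ℤ M) :=
  Ideal.span (Set.range fun a : M => AddMonoidAlgebra.single a (1 : ℤ) - 1)

/-- Translation by `a` is multiplication by `[a]`, so the difference operator in direction `a`
corresponds to multiplication by `[a] - 1`. Degrees thereby turn into powers of the augmentation
ideal. -/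
lemma linearization_sub_one_mul (φ : M → N) (a : M) (x : AddMonoidAlgebra ℤ M) :
    linearization φ ((AddMonoidAlgebra.single a (1 : ℤ) - 1) * x) =
      linearization (fwdDiff a φ) x := by
  have : (linearization φ).comp (AddMonoidHom.mulLeft (AddMonoidAlgebra.single a (1 : ℤ) - 1)) =
      linearization (fwdDiff a φ) := by
    refine AddMonoidAlgebra.addMonoidHom_ext fun b n => ?_
    simp only [AddMonoidHom.comp_apply, AddMonoidHom.coe_mulLeft, sub_mul, one_mul,
      AddMonoidAlgebra.single_mul_single, map_sub, linearization_single, fwdDiff, smul_sub,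
      add_comm a b]
  exact DFunLike.congr_fun this x

lemma DegreeLT.linearization_eq_zero {n : ℕ} {φ : M → N} (h : DegreeLT n φ)
    {x : AddMonoidAlgebra ℤ M} (hx : x ∈ augmentationIdeal M ^ n) : linearization φ x = 0 := by
  induction n generalizing φ x with
  | zero =>
    have : linearization φ = 0 := AddMonoidAlgebra.addMonoidHom_ext fun b n => by
      rw [linearization_single, h b, smul_zero, AddMonoidHom.zero_apply]
    rw [this, AddMonoidHom.zero_apply]
  | succ n ih =>
    rw [pow_succ'] at hx
    refine Submodule.mul_induction_on hx (fun z hz y hy => ?_) fun y z hy hz => by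
      rw [map_add, hy, hz, add_zero]
    induction hz using Submodule.span_induction generalizing y with
    | mem z hz =>
      obtain ⟨a, rfl⟩ := hz
      rw [linearization_sub_one_mul]
      exact ih (h a) hy
    | zero => rw [zero_mul, map_zero]
    | add z z' _ _ hz hz' => rw [add_mul, map_add, hz y hy, hz' y hy, add_zero]
    -- The coefficient `c` is moved to the other factor, which remains in the `n`-th power of the
    -- ideal; for this `y` has to vary in the induction.
    | smul c z _ hz =>
      rw [smul_eq_mul, mul_right_comm, mul_comm _ z, mul_comm c]
      exact hz _ (Ideal.mul_mem_right _ _ hy)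

/-- An algebraic map factors through a homomorphism to the units of a ring which are congruent to
`1` modulo a nilpotent ideal. -/
lemma DegreeLT.exists_factorization {M : Type w} [AddCommMonoid M] {n : ℕ} {φ : M → N}
    (h : DegreeLT n φ) :
    ∃ (R : Type w) (_ : CommRing R) (J : Ideal R) (v : Multiplicative M →* R) (Φ : R →+ N),
      J ^ n = ⊥ ∧ (∀ a, v a - 1 ∈ J) ∧ ∀ a, φ a = Φ (v (Multiplicative.ofAdd a)) := by
  let I := augmentationIdeal M
  -- The universal example: the monoid ring modulo `I ^ n`, with `v a` the class of `[a]` and `Φ`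
  -- the linearization, which is well defined because it kills `I ^ n`.
  refine ⟨AddMonoidAlgebra ℤ M ⧸ I ^ n, inferInstance, I.map (Ideal.Quotient.mk (I ^ n)),
    (Ideal.Quotient.mk (I ^ n) : _ →* _).comp (AddMonoidAlgebra.of ℤ M),
    QuotientAddGroup.lift (I ^ n).toAddSubgroup (linearization φ)
      fun x hx => h.linearization_eq_zero hx, ?_, fun a => ?_, fun a => ?_⟩
  · rw [← Ideal.map_pow, Ideal.map_quotient_self]
  · exact Ideal.mem_map_of_mem (Ideal.Quotient.mk (I ^ n))
      (Ideal.subset_span ⟨a.toAdd, rfl⟩ : AddMonoidAlgebra.single a.toAdd (1 : ℤ) - 1 ∈ I)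
  · refine Eq.symm (Eq.trans ?_ (one_smul ℤ (φ a)))
    exact linearization_single φ a 1

/-! ### Homomorphisms to a ring which are trivial modulo an ideal -/

section Nilpotent

variable {R : Type*} [CommRing R] {J : Ideal R} {n : ℕ}

lemma isUnit_of_sub_one_mem (hJ : J ^ n = ⊥) {x : R} (hx : x - 1 ∈ J) : IsUnit x := by
  have : IsNilpotent (x - 1) := ⟨n, by
    have := Ideal.pow_mem_pow hx n
    rwa [hJ] at this⟩
  simpa using this.isUnit_one_add

/-- A difference in direction `a` replaces `c` by `c * (v a - 1)`, so after `k` of them the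
coefficient has acquired a factor in `J ^ k`. The parameter `c` collects these factors during the
induction. -/
lemma degreeLT_of_sub_one_mem (v : Multiplicative M →* R) (hv : ∀ a, v a - 1 ∈ J) (Φ : R →+ N)
    {k : ℕ} (c : R) (hc : ∀ x ∈ J ^ k, Φ (c * x) = 0) :
    DegreeLT k fun a => Φ (c * v (Multiplicative.ofAdd a)) := by
  induction k generalizing c with
  | zero => exact fun a => hc _ (by simp)
  | succ k ih =>
    intro a
    have : fwdDiff a (fun a => Φ (c * v (Multiplicative.ofAdd a))) =
        fun x => Φ (c * (v (Multiplicative.ofAdd a) - 1) * v (Multiplicative.ofAdd x)) :=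
      funext fun x => by
        simp only [fwdDiff, ofAdd_add, map_mul, ← map_sub]
        congr 1
        ring
    rw [this]
    refine ih _ fun x hx => ?_
    rw [mul_assoc]
    exact hc _ (pow_succ' J k ▸ Ideal.mul_mem_mul (hv _) hx)

/-- If `v - 1` takes values in an ideal, then multiplying a map which is killed by a power of that
ideal with the composite of `v` and an algebraic map preserves algebraicity, with a bound on the
degree depending only on the degrees. -/
lemma exists_degreeLT_mul_comp (v : Multiplicative N →* R) (hv : ∀ a, v a - 1 ∈ J) (n k r : ℕ) :
    ∃ D, ∀ (φ : M → R) (f : M → N), DegreeLT r φ → (∀ x, ∀ c ∈ J ^ k, c * φ x = 0) →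
      DegreeLT n f → DegreeLT D fun x => φ x * v (Multiplicative.ofAdd (f x)) := by
  -- Induction on `n`, then on `k`, then on `r`. A difference of `φ · (v ∘ f)` has two terms. One
  -- contains a difference of `φ` and lowers `r`. The other contains `φ · (v ∘ Δf - 1)`, which
  -- lowers `k` but may raise `r` to the bound that the induction on `n` supplies for `Δf`. That
  -- bound must be uniform in `φ` and `f`, since they change from step to step.
  induction n generalizing k r with
  | zero =>
    refine ⟨r, fun φ f hφ _ hf => ?_⟩
    have : (fun x => φ x * v (Multiplicative.ofAdd (f x))) = φ := funext fun x => by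
      rw [hf x, ofAdd_zero, map_one, mul_one]
    rwa [this]
  | succ n ihn =>
    induction k generalizing r with
    | zero =>
      refine ⟨0, fun φ f _ hc _ x => ?_⟩
      have := hc x 1 (by simp)
      rw [one_mul] at this
      exact (congrArg (· * _) this).trans (zero_mul _)
    | succ k ihk =>
      induction r with
      | zero => exact ⟨0, fun φ f hφ _ _ x => (congrArg (· * _) (hφ x)).trans (zero_mul _)⟩
      | succ r ihr =>
        obtain ⟨D₁, h₁⟩ := ihr
        obtain ⟨D₂, h₂⟩ := ihn (k + 1) (r + 1)
        obtain ⟨D₃, h₃⟩ := ihk (max D₂ (r + 1))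
        refine ⟨max D₁ D₃ + 1, fun φ f hφ hc hf a => ?_⟩
        -- This is `φ · (v ∘ Δf - 1)`. The second factor lies in `J`, so `J ^ k` kills `ψ` as soon
        -- as `J ^ (k + 1)` kills `φ`.
        let ψ : M → R := fun x =>
          φ x * v (Multiplicative.ofAdd (fwdDiff a f x)) + -φ x
        have hψ : DegreeLT (max D₂ (r + 1)) ψ :=
          ((h₂ φ (fwdDiff a f) hφ hc (hf a)).mono (le_max_left _ _)).add
            ((hφ.addHom_comp (-AddMonoidHom.id R)).mono (le_max_right _ _))
        have key : fwdDiff a (fun x => φ x * v (Multiplicative.ofAdd (f x))) = fun x =>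
            fwdDiff a φ x * v (Multiplicative.ofAdd (f (x + a))) +
              ψ x * v (Multiplicative.ofAdd (f x)) := funext fun x => by
          have : f (x + a) = fwdDiff a f x + f x := by simp [fwdDiff]
          simp only [fwdDiff, ψ] at this ⊢
          rw [this, ofAdd_add, map_mul]
          simp only [sub_add_cancel]
          ring
        rw [key]
        refine ((h₁ _ (fun x => f (x + a)) (hφ a) (fun x c hx => ?_) (hf.translate a)).mono
          (le_max_left _ _)).add ((h₃ ψ f hψ (fun x c hx => ?_) hf).mono (le_max_right _ _))
        · simp only [fwdDiff, mul_sub, hc _ c hx, sub_zero]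
        · have := hc x _ (pow_succ J k ▸ Ideal.mul_mem_mul hx
            (hv (Multiplicative.ofAdd (fwdDiff a f x))))
          rw [← this]
          simp only [ψ]
          ring

end Nilpotent

/-! ### Closure properties of algebraic maps -/

namespace IsAlgebraicMap

lemma add {φ ψ : M → N} (h : IsAlgebraicMap φ) (h' : IsAlgebraicMap ψ) :
    IsAlgebraicMap fun x => φ x + ψ x := by
  obtain ⟨n, hn⟩ := h
  obtain ⟨m, hm⟩ := h'
  exact ⟨max n m, (hn.mono (le_max_left _ _)).add (hm.mono (le_max_right _ _))⟩

lemma addHom_comp {φ : M → N} (h : IsAlgebraicMap φ) (g : N →+ N') :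
    IsAlgebraicMap fun x => g (φ x) := h.imp fun _ h => h.addHom_comp g

lemma comp_addHom {φ : M → N} (h : IsAlgebraicMap φ) (f : M' →+ M) :
    IsAlgebraicMap fun x => φ (f x) := h.imp fun _ h => h.comp_addHom f

lemma addHom (f : M →+ N) : IsAlgebraicMap f := by
  refine ⟨2, fun a => ?_⟩
  have : fwdDiff a f = fun _ => f a := funext fun x => by simp [fwdDiff]
  rw [this]
  exact DegreeLT.const _

/-- The composite of two algebraic maps is algebraic. -/
lemma comp {g : N → N'} {f : M → N} (hg : IsAlgebraicMap g) (hf : IsAlgebraicMap f) :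
    IsAlgebraicMap fun x => g (f x) := by
  obtain ⟨m, hm⟩ := hg
  obtain ⟨n, hn⟩ := hf
  obtain ⟨R, _, J, v, Φ, hJ, hv, hΦ⟩ := hm.exists_factorization
  -- The outer map is `Φ ∘ v`, so it suffices to treat `v ∘ f = 1 · (v ∘ f)`. The constant `1` has
  -- degree `< 1` and is killed by `J ^ m = 0`.
  obtain ⟨D, hD⟩ := exists_degreeLT_mul_comp (M := M) v hv n m 1
  refine ⟨D, ?_⟩
  have := (hD (fun _ => 1) f (DegreeLT.const 1) (fun _ c hc => ?_) hn).addHom_comp Φ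
  · simpa only [one_mul, ← hΦ] using this
  · rw [hJ] at hc
    rw [(Submodule.mem_bot R).1 hc, zero_mul]

end IsAlgebraicMap

lemma grothendieck_ind {P : GrothendieckAddGroup M → Prop}
    (h : ∀ a b : M, P (GrothendieckAddGroup.of a - GrothendieckAddGroup.of b))
    (x : GrothendieckAddGroup M) : P x := by
  induction x using AddLocalization.ind with | _ y
  have := h y.1 y.2
  rwa [show GrothendieckAddGroup.of y.1 - GrothendieckAddGroup.of (y.2 : M) =
    AddLocalization.mk y.1 y.2 from ?_] at this
  rw [AddLocalization.mk_eq_addMonoidOf_mk', sub_eq_iff_eq_add]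
  exact ((AddLocalization.addMonoidOf (⊤ : AddSubmonoid M)).mk'_spec y.1 y.2).symm

/-- The difference of `g` in the direction of an element `b` of the monoid again vanishes on the
monoid and has smaller degree, so it is zero. At `a - b` this says `g (a - b) = g a = 0`, and every
element has the form `a - b`. -/
lemma DegreeLT.eq_zero {n : ℕ} {g : GrothendieckAddGroup M → N} (h : DegreeLT n g)
    (h0 : ∀ m, g (GrothendieckAddGroup.of m) = 0) (x : GrothendieckAddGroup M) : g x = 0 := by
  induction n generalizing g x with
  | zero => exact h x
  | succ n ih =>
    induction x using grothendieck_ind with | _ a b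
    have := ih (h (GrothendieckAddGroup.of b)) (fun m => by
      rw [fwdDiff, ← map_add, h0, h0, sub_zero])
      (GrothendieckAddGroup.of a - GrothendieckAddGroup.of b)
    rw [fwdDiff, sub_add_cancel, h0, zero_sub, neg_eq_zero] at this
    exact this

/-- Algebraic maps on a Grothendieck group are determined by their values on the monoid. -/
lemma IsAlgebraicMap.ext {g g' : GrothendieckAddGroup M → N} (h : IsAlgebraicMap g)
    (h' : IsAlgebraicMap g')
    (h0 : ∀ m, g (GrothendieckAddGroup.of m) = g' (GrothendieckAddGroup.of m)) : g = g' := by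
  obtain ⟨n, hn⟩ := h.add (h'.addHom_comp (-AddMonoidHom.id N))
  refine funext fun x => eq_of_sub_eq_zero ?_
  rw [sub_eq_add_neg]
  exact hn.eq_zero (fun m => (congrArg (· + -g' _) (h0 m)).trans (add_neg_cancel _)) x

/-- An algebraic map on a monoid has an algebraic extension to the Grothendieck group. -/
lemma IsAlgebraicMap.exists_extension {φ : M → N} (h : IsAlgebraicMap φ) :
    ∃ g, IsAlgebraicExtension φ g := by
  obtain ⟨n, hn⟩ := h
  obtain ⟨R, _, J, v, Φ, hJ, hv, hΦ⟩ := hn.exists_factorization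
  -- The values of `v` are units because `v - 1` is nilpotent. As units form a group, the universal
  -- property of the Grothendieck group extends `v` to `V`.
  let v' : Multiplicative M →* Rˣ :=
    Units.liftRight v (fun a => (isUnit_of_sub_one_mem hJ (hv a)).unit) fun _ => rfl
  let V : GrothendieckAddGroup M →+ Additive Rˣ :=
    GrothendieckAddGroup.lift (MonoidHom.toAdditiveRight v')
  let V' : Multiplicative (GrothendieckAddGroup M) →* R :=
    (Units.coeHom R).comp (AddMonoidHom.toMultiplicativeLeft V)
  have hV : ∀ m, V' (Multiplicative.ofAdd (GrothendieckAddGroup.of m)) =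
      v (Multiplicative.ofAdd m) := fun m => by
    have := DFunLike.congr_fun
      (GrothendieckAddGroup.lift.symm_apply_apply (MonoidHom.toAdditiveRight v')) m
    exact congrArg (fun z : Additive Rˣ => ((Additive.toMul z : Rˣ) : R)) this
  -- Modulo `J` the homomorphism is trivial on the monoid, hence also on differences. With `J ^ n =
  -- 0` this bounds the degree of the extension.
  have hV' : ∀ x, V' (Multiplicative.ofAdd x) - 1 ∈ J := fun x => by
    rw [← Ideal.Quotient.eq_zero_iff_mem, map_sub, map_one, sub_eq_zero]
    have h1 : ∀ m, Ideal.Quotient.mk J (V' (Multiplicative.ofAdd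
        (GrothendieckAddGroup.of m))) = 1 := fun m => by
      rw [hV, ← sub_eq_zero, ← map_one (Ideal.Quotient.mk J), ← map_sub]
      exact Ideal.Quotient.eq_zero_iff_mem.2 (hv _)
    induction x using grothendieck_ind with | _ a b
    have := congrArg (Ideal.Quotient.mk J) (map_mul V'
      (Multiplicative.ofAdd (GrothendieckAddGroup.of a - GrothendieckAddGroup.of b))
      (Multiplicative.ofAdd (GrothendieckAddGroup.of b)))
    rw [← ofAdd_add, sub_add_cancel, map_mul, h1, h1, mul_one] at this
    exact this.symm
  refine ⟨fun x => Φ (V' (Multiplicative.ofAdd x)), ⟨n, ?_⟩, fun m => (congrArg Φ (hV m)).trans (hΦ m).symm⟩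
  have := degreeLT_of_sub_one_mem (M := GrothendieckAddGroup M) V' hV' Φ (k := n) 1
    fun x hx => by
      rw [hJ] at hx
      rw [(Submodule.mem_bot R).1 hx, mul_zero, map_zero]
  simpa only [one_mul] using this

lemma IsAlgebraicMap.algExt_spec {φ : M → N} (h : IsAlgebraicMap φ) :
    IsAlgebraicExtension φ (algExt φ) := by
  rw [algExt, dif_pos h.exists_extension]
  exact h.exists_extension.choose_spec

lemma IsAlgebraicMap.existsUnique_extension {φ : M → N} (h : IsAlgebraicMap φ) :
    ∃! g, IsAlgebraicExtension φ g :=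
  ⟨_, h.algExt_spec, fun _ hg => hg.1.ext h.algExt_spec.1 fun m =>
    (hg.2 m).trans (h.algExt_spec.2 m).symm⟩

lemma groupMap_of {M N : Type*} [AddCommMonoid M] [AddCommMonoid N] (f : M →+ N) (m : M) :
    groupMap f (GrothendieckAddGroup.of m) = GrothendieckAddGroup.of (f m) :=
  DFunLike.congr_fun
    (GrothendieckAddGroup.lift.symm_apply_apply (GrothendieckAddGroup.of.comp f)) m

end AlgebraicMaps

/-! ### Transport of structure along isomorphisms -/

section Transport

universe w'

variable {G : Type u} [Group G]

lemma IsSemiMackey.of_equiv {M : FinGSet G → Type w} {N : FinGSet G → Type w'}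
    {res : ∀ {X Y : FinGSet G}, (X →[G] Y) → M Y → M X}
    {tr : ∀ {X Y : FinGSet G}, (X →[G] Y) → M X → M Y}
    {res' : ∀ {X Y : FinGSet G}, (X →[G] Y) → N Y → N X}
    {tr' : ∀ {X Y : FinGSet G}, (X →[G] Y) → N X → N Y}
    (h : IsSemiMackey G N res' tr') (e : ∀ X, M X ≃ N X)
    (hres : ∀ {X Y : FinGSet G} (f : X →[G] Y) (m : M Y), e X (res f m) = res' f (e Y m))
    (htr : ∀ {X Y : FinGSet G} (f : X →[G] Y) (m : M X), e Y (tr f m) = tr' f (e X m)) :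
    IsSemiMackey G M res tr where
  res_id X m := (e X).injective (by rw [hres, h.res_id])
  res_comp g f m := (e _).injective (by rw [hres, hres, hres, h.res_comp])
  tr_id X m := (e X).injective (by rw [htr, h.tr_id])
  tr_comp g f m := (e _).injective (by rw [htr, htr, htr, h.tr_comp])
  mackey f' g' g f hsq m := (e _).injective (by rw [hres, htr, htr, hres, h.mackey f' g' g f hsq])
  subsingleton X hX := haveI := h.subsingleton X hX; (e X).subsingleton
  additive {X Y Z} i j hij := by
    have h1 := (((e X).prodCongr (e Y)).symm.bijective.comp (h.additive i j hij)).comp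
      (e Z).bijective
    convert h1 using 1
    funext m
    refine Prod.ext ?_ ?_
    · exact ((e X).symm_apply_eq.2 (hres i m).symm).symm
    · exact ((e Y).symm_apply_eq.2 (hres j m).symm).symm

lemma TambaraData.IsSemiTambara.of_equiv {S : TambaraData.{u, w} G} {T : TambaraData.{u, w'} G}
    (h : T.IsSemiTambara) (e : ∀ X, S.obj X ≃+* T.obj X)
    (hres : ∀ {X Y : FinGSet G} (f : X →[G] Y) (m : S.obj Y),
      e X (S.res f m) = T.res f (e Y m))
    (htr : ∀ {X Y : FinGSet G} (f : X →[G] Y) (m : S.obj X), e Y (S.tr f m) = T.tr f (e X m))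
    (hnm : ∀ {X Y : FinGSet G} (f : X →[G] Y) (m : S.obj X), e Y (S.nm f m) = T.nm f (e X m)) :
    S.IsSemiTambara where
  additive := h.additive.of_equiv (fun X => (e X).toEquiv) hres htr
  multiplicative := h.multiplicative.of_equiv (fun X => (e X).toEquiv) hres hnm
  nm_one f := (e _).injective (by rw [hnm, map_one, map_one, h.nm_one])
  nm_mul f a b := (e _).injective (by rw [hnm, map_mul, map_mul, hnm, hnm, h.nm_mul])
  exponential η ξ ζ η' υ hexp a := (e _).injective (by
    rw [htr, hnm, hres, hnm, htr, h.exponential η ξ ζ η' υ hexp])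

end Transport

/-! ### Ring completion of semi-Tambara functors -/

section Completion

/-! ### Functoriality of ring completion -/

namespace K0

variable {S T : Type*} [CommSemiring S] [CommSemiring T] {N : Type*} [AddCommGroup N]

lemma map_of (f : S →+* T) (s : S) : K0.map f (K0.of s) = K0.of (f s) :=
  K0.addMap_of f.toAddMonoidHom s

lemma alg_ext {g g' : K0 S → N} (h : IsAlgebraicMap g) (h' : IsAlgebraicMap g')
    (h0 : ∀ m, g (K0.of m) = g' (K0.of m)) : g = g' :=
  IsAlgebraicMap.ext (M := S) h h' h0

lemma exists_sub (x : K0 S) : ∃ a b, x = K0.of a - K0.of b := by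
  induction x using grothendieck_ind (M := S) with | _ a b
  exact ⟨a, b, rfl⟩

/-- Group completion commutes with binary products. Only the additive structure matters: the
inclusions `i'` and `j'` of the two factors are merely additive, and the identities which express
the direct sum decomposition pass to the completions by additivity. -/
lemma map_prod_bijective {A B C : Type*} [CommSemiring A] [CommSemiring B] [CommSemiring C]
    {i : A →+* B} {j : A →+* C} (h : Bijective fun a => (i a, j a)) :
    Bijective fun a => (K0.map i a, K0.map j a) := by
  let e : A ≃+ B × C := AddEquiv.ofBijective ((i : A →+ B).prod (j : A →+ C)) h
  let i' : B →+ A := e.symm.toAddMonoidHom.comp (AddMonoidHom.inl B C)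
  let j' : C →+ A := e.symm.toAddMonoidHom.comp (AddMonoidHom.inr B C)
  have hi : ∀ b, (i (i' b), j (i' b)) = (b, 0) := fun b => e.apply_symm_apply (b, 0)
  have hj : ∀ c, (i (j' c), j (j' c)) = (0, c) := fun c => e.apply_symm_apply (0, c)
  have hij : ∀ a, i' (i a) + j' (j a) = a := fun a => by
    refine e.injective ((map_add e _ _).trans (Prod.ext ?_ ?_))
    · exact (congrArg₂ (· + ·) (congrArg Prod.fst (hi (i a)))
        (congrArg Prod.fst (hj (j a)))).trans (add_zero _)
    · exact (congrArg₂ (· + ·) (congrArg Prod.snd (hi (i a)))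
        (congrArg Prod.snd (hj (j a)))).trans (zero_add _)
  have hleft : ∀ a, K0.addMap i' (K0.map i a) + K0.addMap j' (K0.map j a) = a := fun a => by
    obtain ⟨s, t, rfl⟩ := exists_sub a
    simp only [map_sub, map_of, addMap_of]
    rw [sub_add_sub_comm, ← map_add, ← map_add, hij, hij]
  have h11 : ∀ b, K0.map i (K0.addMap i' b) = b := fun b => by
    have : (K0.map i : K0 A →+ K0 B).comp (K0.addMap i') = AddMonoidHom.id _ :=
      K0.hom_ext fun s => by
        simpa [map_of, addMap_of] using congrArg (fun z => K0.of z.1) (hi s)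
    exact DFunLike.congr_fun this b
  have h21 : ∀ b, K0.map j (K0.addMap i' b) = 0 := fun b => by
    have : (K0.map j : K0 A →+ K0 C).comp (K0.addMap i') = 0 :=
      K0.hom_ext fun s => by
        simpa [map_of, addMap_of] using congrArg (fun z => K0.of z.2) (hi s)
    exact DFunLike.congr_fun this b
  have h12 : ∀ c, K0.map i (K0.addMap j' c) = 0 := fun c => by
    have : (K0.map i : K0 A →+ K0 B).comp (K0.addMap j') = 0 :=
      K0.hom_ext fun s => by
        simpa [map_of, addMap_of] using congrArg (fun z => K0.of z.1) (hj s)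
    exact DFunLike.congr_fun this c
  have h22 : ∀ c, K0.map j (K0.addMap j' c) = c := fun c => by
    have : (K0.map j : K0 A →+ K0 C).comp (K0.addMap j') = AddMonoidHom.id _ :=
      K0.hom_ext fun s => by
        simpa [map_of, addMap_of] using congrArg (fun z => K0.of z.2) (hj s)
    exact DFunLike.congr_fun this c
  refine ⟨fun a b hab => ?_, fun bc => ⟨K0.addMap i' bc.1 + K0.addMap j' bc.2, ?_⟩⟩
  · rw [← hleft a, ← hleft b, (Prod.mk.inj hab).1, (Prod.mk.inj hab).2]
  · refine Prod.ext ?_ ?_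
    · exact (map_add _ _ _).trans (by rw [h11, h12, add_zero])
    · exact (map_add _ _ _).trans (by rw [h21, h22, zero_add])

/-- An isomorphism of semirings induces an isomorphism of the ring completions. -/
noncomputable def mapEquiv (e : S ≃+* T) : K0 S ≃+* K0 T where
  __ := K0.map (e : S →+* T)
  invFun := K0.map (e.symm : T →+* S)
  left_inv a := by
    have : (K0.map (e.symm : T →+* S) : K0 T →+ K0 S).comp (K0.map (e : S →+* T) : K0 S →+ K0 T) =
        AddMonoidHom.id _ := K0.hom_ext fun s => by simp [map_of]
    exact DFunLike.congr_fun this a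
  right_inv a := by
    have : (K0.map (e : S →+* T) : K0 S →+ K0 T).comp (K0.map (e.symm : T →+* S) : K0 T →+ K0 S) =
        AddMonoidHom.id _ := K0.hom_ext fun s => by simp [map_of]
    exact DFunLike.congr_fun this a

lemma mapEquiv_of (e : S ≃+* T) (s : S) : mapEquiv e (K0.of s) = K0.of (e s) :=
  map_of (e : S →+* T) s

lemma subsingleton [Subsingleton S] : Subsingleton (K0 S) := by
  refine ⟨fun x y => ?_⟩
  obtain ⟨a, b, rfl⟩ := exists_sub x
  obtain ⟨c, d, rfl⟩ := exists_sub y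
  rw [Subsingleton.elim a c, Subsingleton.elim b d]

end K0

variable {G : Type u} [Group G]

/-! ### From semi-Tambara axioms to Tambara axioms -/

namespace TambaraData

/-- The multiplicative transfers of `S` become algebraic maps after ring completion. -/
def HasAlgebraicNm (S : TambaraData.{u, w} G) : Prop :=
  ∀ (X Y : FinGSet G) (f : X →[G] Y), IsAlgebraicMap fun a => K0.of (S.nm f a)

variable {S : TambaraData.{u, w} G} {X Y : FinGSet G}

variable (S) in
/-- The multiplicative transfers of the ring completion. -/
noncomputable def completionNm (f : X →[G] Y) : K0 (S.obj X) → K0 (S.obj Y) :=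
  algExt (M := S.obj X) fun a => K0.of (S.nm f a)

lemma HasAlgebraicNm.completionNm_of (h : S.HasAlgebraicNm) (f : X →[G] Y) (a : S.obj X) :
    S.completionNm f (K0.of a) = K0.of (S.nm f a) := (h X Y f).algExt_spec.2 a

lemma HasAlgebraicNm.isAlgebraicMap (h : S.HasAlgebraicNm) (f : X →[G] Y) :
    IsAlgebraicMap (S.completionNm f) := (h X Y f).algExt_spec.1

lemma completion_isSemiMackey (h : S.IsSemiTambara) :
    IsSemiMackey G (fun X => K0 (S.obj X)) (fun f => K0.map (S.res f))
      (fun f => K0.addMap (S.tr f)) where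
  res_id X m := by
    obtain ⟨a, b, rfl⟩ := K0.exists_sub m
    simp only [map_sub, K0.map_of, h.additive.res_id]
  res_comp g f m := by
    obtain ⟨a, b, rfl⟩ := K0.exists_sub m
    simp only [map_sub, K0.map_of, h.additive.res_comp]
  tr_id X m := by
    obtain ⟨a, b, rfl⟩ := K0.exists_sub m
    simp only [map_sub, K0.addMap_of, h.additive.tr_id]
  tr_comp g f m := by
    obtain ⟨a, b, rfl⟩ := K0.exists_sub m
    simp only [map_sub, K0.addMap_of, h.additive.tr_comp]
  mackey f' g' g f hsq m := by
    obtain ⟨a, b, rfl⟩ := K0.exists_sub m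
    simp only [map_sub, K0.map_of, K0.addMap_of, h.additive.mackey f' g' g f hsq]
  subsingleton X hX := haveI := h.additive.subsingleton X hX; K0.subsingleton
  additive i j hij := K0.map_prod_bijective (h.additive.additive i j hij)

/-- Both sides of each identity for transfers are algebraic, so they agree once they agree on
classes from `S`. Functoriality is the place where composites of two genuinely non-additive
algebraic maps occur. The remaining axioms concern restrictions only. -/
lemma completion_isSemiMackey_nm (h : S.IsSemiTambara) (hS : S.HasAlgebraicNm) :
    IsSemiMackey G (fun X => K0 (S.obj X)) (fun f => K0.map (S.res f))
      (fun f => S.completionNm f) where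
  res_id := (completion_isSemiMackey h).res_id
  res_comp := (completion_isSemiMackey h).res_comp
  tr_id X m := congrFun (K0.alg_ext (hS.isAlgebraicMap (idm X))
    (IsAlgebraicMap.addHom (AddMonoidHom.id _)) fun a => by
      rw [hS.completionNm_of, h.multiplicative.tr_id, AddMonoidHom.id_apply]) m
  tr_comp g f m := congrFun (K0.alg_ext (hS.isAlgebraicMap (comp g f))
    ((hS.isAlgebraicMap g).comp (hS.isAlgebraicMap f)) fun a => by
      rw [hS.completionNm_of, hS.completionNm_of, hS.completionNm_of,
        h.multiplicative.tr_comp g f a]) m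
  mackey f' g' g f hsq m := congrFun (K0.alg_ext
    ((hS.isAlgebraicMap g).addHom_comp (K0.map (S.res f)).toAddMonoidHom)
    ((hS.isAlgebraicMap g').comp_addHom (K0.map (S.res f')).toAddMonoidHom) fun a => by
      change K0.map (S.res f) _ = S.completionNm g' (K0.map (S.res f') _)
      rw [hS.completionNm_of, K0.map_of, K0.map_of, hS.completionNm_of,
        h.multiplicative.mackey f' g' g f hsq a]) m
  subsingleton := (completion_isSemiMackey h).subsingleton
  additive := (completion_isSemiMackey h).additive

/-- The two variables are treated one at a time. Multiplication by a fixed element is additive, so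
with one factor fixed both sides are algebraic in the other: `a` is extended first while `b` comes
from the semiring, then `b`. -/
lemma completionNm_mul (h : S.IsSemiTambara) (hS : S.HasAlgebraicNm) (f : X →[G] Y)
    (a b : K0 (S.obj X)) :
    S.completionNm f (a * b) = S.completionNm f a * S.completionNm f b := by
  have key : ∀ (s : S.obj X), S.completionNm f (a * K0.of s) =
      S.completionNm f a * S.completionNm f (K0.of s) := fun s =>
    congrFun (K0.alg_ext
      ((hS.isAlgebraicMap f).comp_addHom (AddMonoidHom.mulRight (K0.of s)))
      ((hS.isAlgebraicMap f).addHom_comp (AddMonoidHom.mulRight (S.completionNm f (K0.of s))))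
      fun t => by
        change S.completionNm f (K0.of t * K0.of s) =
          S.completionNm f (K0.of t) * S.completionNm f (K0.of s)
        rw [← K0.of_mul, hS.completionNm_of, hS.completionNm_of, hS.completionNm_of, h.nm_mul, K0.of_mul]) a
  exact congrFun (K0.alg_ext ((hS.isAlgebraicMap f).comp_addHom (AddMonoidHom.mulLeft a))
    ((hS.isAlgebraicMap f).addHom_comp (AddMonoidHom.mulLeft (S.completionNm f a))) key) b

/-- The ring completion of a semi-Tambara functor is a Tambara functor, if its multiplicative
transfers have algebraic extensions. -/
theorem IsSemiTambara.completion (h : S.IsSemiTambara) (hS : S.HasAlgebraicNm) :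
    S.completion.IsTambara where
  additive := completion_isSemiMackey h
  multiplicative := completion_isSemiMackey_nm h hS
  nm_one f := (hS.completionNm_of f 1).trans (congrArg _ (h.nm_one f))
  nm_mul f a b := completionNm_mul h hS f a b
  exponential η ξ ζ η' υ hexp a := congrFun (K0.alg_ext
    (((hS.isAlgebraicMap η').comp_addHom (K0.map (S.res ζ)).toAddMonoidHom).addHom_comp
      (K0.addMap (S.tr υ)))
    ((hS.isAlgebraicMap η).comp_addHom (K0.addMap (S.tr ξ))) fun a => by
      change K0.addMap (S.tr υ) (S.completionNm η' (K0.map (S.res ζ) _)) = _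
      rw [K0.map_of, hS.completionNm_of, K0.addMap_of, K0.addMap_of, hS.completionNm_of,
        h.exponential η ξ ζ η' υ hexp a]) a
  exists_neg X a := ⟨-(show K0 (S.obj X) from a), add_neg_cancel (show K0 (S.obj X) from a)⟩

end TambaraData

end Completion

/-! ### Multiplicative transfers of Burnside groups are algebraic -/

section BurnsideAlgebraic

open Algebra

variable {G : Type u} [Group G] {A B U V W X Y Z : FinGSet G}

/-! ### Sections meeting prescribed parts of a labelled `G`-set -/

namespace FinGSet

/-- The function on `A ⨿ B` given by functions on `A` and `B`. -/
def sumLabel (l : A → ℕ) (l' : B → ℕ) : A.sum B → ℕ := Sum.elim l l'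

lemma smul_section {η : X →[G] Y} {p : A →[G] X} (g : G) (s : dprod η p) (x : X)
    (hx : η x = s.1) (hx' : η (g • x) = (g • s).1) :
    (g • s).2.1 ⟨g • x, hx'⟩ = g • s.2.1 ⟨x, hx⟩ :=
  congrArg (fun a => g • a) (SectionPair.congr s (inv_smul_smul g x) _ _)

/-- The `G`-set of sections in `Π_η(A)` which take each of the labels `1, …, j`. -/
def hitting (η : X →[G] Y) (p : A →[G] X) (l : A → ℕ) (hl : ∀ (g : G) a, l (g • a) = l a)
    (j : ℕ) : FinGSet G where
  carrier := {s : dprod η p // ∀ i < j, ∃ x, l (s.2.1 x) = i + 1}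
  action :=
    { smul := fun g s => ⟨g • s.1, fun i hi => by
        obtain ⟨x, hx⟩ := s.2 i hi
        have hgx : η (g • x.1) = (g • s.1).1 := (map_smul η g x.1).trans (congrArg _ x.2)
        exact ⟨⟨g • x.1, hgx⟩, by rw [smul_section g s.1 x.1 x.2 hgx, hl, hx]⟩⟩
      one_smul := fun s => Subtype.ext (one_smul G s.1)
      mul_smul := fun g h s => Subtype.ext (mul_smul g h s.1) }

/-- The projection of the `G`-set of sections taking given labels. -/
def hittingProj (η : X →[G] Y) (p : A →[G] X) (l : A → ℕ) (hl : ∀ (g : G) a, l (g • a) = l a)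
    (j : ℕ) : hitting η p l hl j →[G] Y where
  toFun s := s.1.1
  map_smul' _ _ := rfl

/-- Composition of sections with a label preserving map. -/
def hittingMap (η : X →[G] Y) {p : A →[G] X} {q : B →[G] X} {l : A → ℕ}
    {hl : ∀ (g : G) a, l (g • a) = l a} {l' : B → ℕ} {hl' : ∀ (g : G) a, l' (g • a) = l' a}
    {j j' : ℕ} (f : A →[G] B) (hf : ∀ a, q (f a) = p a) (hj : j' ≤ j)
    (hll' : ∀ a, ∀ i < j', l a = i + 1 → l' (f a) = i + 1) :
    hitting η p l hl j →[G] hitting η q l' hl' j' where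
  toFun s := ⟨dmap f hf s.1, fun i hi => by
    obtain ⟨x, hx⟩ := s.2 i (hi.trans_le hj)
    exact ⟨x, hll' _ i hi hx⟩⟩
  map_smul' g s := Subtype.ext (map_smul (dmap f hf) g s.1)

lemma exists_dmap_eq {η : X →[G] Y} {p : A →[G] X} {q : B →[G] X} (f : A →[G] B)
    (hf : ∀ a, q (f a) = p a) (t : dprod η q) (ht : ∀ x, ∃ a, f a = t.2.1 x) :
    ∃ s : dprod η p, dmap f hf s = t := by
  choose σ hσ using ht
  exact ⟨⟨t.1, σ, fun x => (hf _).symm.trans ((congrArg q (hσ x)).trans (t.2.2 x))⟩,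
    SectionPair.ext rfl fun x _ _ => hσ _⟩

lemma dmap_injective {η : X →[G] Y} {p : A →[G] X} {q : B →[G] X} {f : A →[G] B}
    (hf : ∀ a, q (f a) = p a) (hinj : Function.Injective f) :
    Function.Injective (dmap (η := η) f hf) := by
  rintro ⟨y, σ⟩ ⟨z, τ⟩ h
  obtain rfl : y = z := congrArg (dproj η q) h
  refine congrArg (Sigma.mk y) (Subtype.ext (funext fun x => hinj ?_))
  exact congrFun (congrArg Subtype.val (eq_of_heq (Sigma.mk.inj h).2)) x

end FinGSet

/-! ### Iterated differences of the dependent product -/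

namespace OverClass

lemma mk_add (p : A →[G] W) (q : B →[G] W) : mk p + mk q = mk (sumElim p q) := rfl

lemma mk_eq_zero [IsEmpty A] (p : A →[G] W) : mk p = 0 :=
  (sound (fromEmpty A) ⟨fun x => isEmptyElim x, fun x => isEmptyElim x⟩
    fun x => isEmptyElim x).symm

/-- The class of the `G`-set of sections which take each of the labels `1, …, j`. -/
def hit (f : V →[G] W) (p : A →[G] V) (l : A → ℕ) (hl : ∀ (g : G) a, l (g • a) = l a) (j : ℕ) :
    OverClass W := mk (hittingProj f p l hl j)

variable {f : V →[G] W} {p : A →[G] V} {q : B →[G] V} {l : A → ℕ}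
  {hl : ∀ (g : G) a, l (g • a) = l a} {l' : B → ℕ} {hl' : ∀ (g : G) a, l' (g • a) = l' a} {j : ℕ}

lemma hit_congr (e : A →[G] B) (he : Bijective e) (hp : ∀ a, q (e a) = p a)
    (h : ∀ a, l' (e a) = l a) : hit f p l hl j = hit f q l' hl' j := by
  refine sound (hittingMap f e hp le_rfl fun a i _ ha => (h a).trans ha) ⟨?_, fun t => ?_⟩
    fun _ => rfl
  · exact fun s t hst => Subtype.ext (dmap_injective hp he.1 (congrArg Subtype.val hst))
  · obtain ⟨s, hs⟩ := exists_dmap_eq e hp t.1 fun x => he.2 _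
    refine ⟨⟨s, fun i hi => ?_⟩, Subtype.ext hs⟩
    have := t.2 i hi
    rw [← hs] at this
    obtain ⟨x, hx⟩ := this
    exact ⟨x, (h _).symm.trans hx⟩

lemma hit_zero : hit f p l hl 0 = nm f (mk p) :=
  sound ⟨Subtype.val, fun _ _ => rfl⟩
    ⟨Subtype.val_injective, fun s => ⟨⟨s, fun i hi => absurd hi i.not_lt_zero⟩, rfl⟩⟩ fun _ => rfl

/-- Pigeonhole: taking `j` different labels requires `j` different points in the fibre on which the
section is defined. -/
lemma hit_eq_zero (h : ∀ y, Nat.card {x : V // f x = y} < j) : hit f p l hl j = 0 := by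
  have : IsEmpty (hitting f p l hl j) := ⟨fun s => by
    choose x hx using fun i : Fin j => s.2 i.1 i.2
    have hinj : Function.Injective x := fun a b hab => Fin.ext (by
      have := hx a
      rw [hab, hx b] at this
      omega)
    have := Nat.card_le_card_of_injective x hinj
    rw [Nat.card_fin] at this
    exact absurd (h s.1.1) this.not_gt⟩
  exact mk_eq_zero _

/-- Sections either avoid the part of `A` with the new label `j + 1`, or take that label. -/
lemma hit_add_hit {l₁ : A → ℕ} {hl₁ : ∀ (g : G) a, l₁ (g • a) = l₁ a} (e : B →[G] A)
    (he : Function.Injective e) (hrange : ∀ a, (∃ b, e b = a) ↔ l₁ a ≠ j + 1)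
    (hp : ∀ b, p (e b) = q b) (h : ∀ b, l (e b) = l' b)
    (h₁ : ∀ a, ∀ i < j, l a = i + 1 ↔ l₁ a = i + 1) :
    hit f q l' hl' j + hit f p l₁ hl₁ (j + 1) = hit f p l hl j := by
  -- The map `α` includes the sections with values in the part `B`, which avoid the label `j + 1`;
  -- `β` forgets the condition at the label `j + 1`. Their images are disjoint and cover everything.
  let α : hitting f q l' hl' j →[G] hitting f p l hl j :=
    hittingMap f e hp le_rfl fun b i _ hb => (h b).trans hb
  let β : hitting f p l₁ hl₁ (j + 1) →[G] hitting f p l hl j :=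
    hittingMap f (idm A) (fun _ => rfl) j.le_succ fun a i hi ha => (h₁ a i hi).2 ha
  have hβ : ∀ t, (β t).1 = t.1 := fun t => SectionPair.ext rfl fun _ _ _ => rfl
  have hαβ : ∀ s t, α s ≠ β t := fun s t hst => by
    have h2 := (congrArg Subtype.val hst).trans (hβ t)
    have h3 := t.2 j j.lt_succ_self
    rw [← h2] at h3
    obtain ⟨x, hx⟩ := h3
    exact (hrange _).1 ⟨_, rfl⟩ hx
  refine sound (sumElim α β) ⟨?_, fun t => ?_⟩ ?_
  · rintro (s | s) (t | t) hst
    · exact congrArg Sum.inl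
        (Subtype.ext (dmap_injective hp he (congrArg Subtype.val hst)))
    · exact (hαβ s t hst).elim
    · exact (hαβ t s hst.symm).elim
    · exact congrArg Sum.inr (Subtype.ext
        (((hβ s).symm.trans (congrArg Subtype.val hst)).trans (hβ t)))
  · by_cases ht : ∃ x, l₁ (t.1.2.1 x) = j + 1
    · refine ⟨Sum.inr ⟨t.1, fun i hi => ?_⟩, Subtype.ext (hβ _)⟩
      rcases Nat.lt_succ_iff_lt_or_eq.1 hi with hi | rfl
      · obtain ⟨x, hx⟩ := t.2 i hi
        exact ⟨x, (h₁ _ i hi).1 hx⟩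
      · exact ht
    · obtain ⟨s, hs⟩ := exists_dmap_eq e hp t.1 fun x =>
        (hrange _).2 fun hx => ht ⟨x, hx⟩
      refine ⟨Sum.inl ⟨s, fun i hi => ?_⟩, Subtype.ext hs⟩
      have := t.2 i hi
      rw [← hs] at this
      obtain ⟨x, hx⟩ := this
      exact ⟨x, (h _).symm.trans hx⟩
  · rintro (s | s) <;> rfl

/-- Here `Z` is the union of the `j` increments already taken, labelled `1, …, j`, while the
variable `A` has label `0`, on which no condition is imposed. A further difference in direction `B`
keeps exactly the sections which meet `B`: it adds `B` to `Z` with the label `j + 1` and trades one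
unit of `k` for one of `j`. At `k = 0` there are more labels than points in any fibre. -/
lemma degreeLT_of_hit (f : V →[G] W) (k : ℕ) {j : ℕ}
    (hj : ∀ y, Nat.card {x : V // f x = y} < j + k) (q : Z →[G] V) (l : Z → ℕ)
    (hl : ∀ (g : G) z, l (g • z) = l z) (hlj : ∀ z, l z ≤ j)
    (φ : OverClass V → Burnside W)
    (hφ : ∀ (A : FinGSet G) (p : A →[G] V), φ (mk p) = GrothendieckAddGroup.of
      (hit f (sumElim p q) (sumLabel (fun _ => 0) l)
        (by rintro g (a | z); exacts [rfl, hl g z]) j)) :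
    DegreeLT k φ := by
  induction k generalizing Z j φ with
  | zero =>
    intro a
    induction a using ind with | _ A p
    exact (hφ A p).trans ((congrArg _ (hit_eq_zero hj)).trans (map_zero _))
  | succ k ih =>
    intro b
    induction b using ind with | _ B r
    refine ih (j := j + 1) (fun y => (hj y).trans_eq (by omega)) (sumElim r q)
      (sumLabel (fun _ => j + 1) l) (by rintro g (a | z); exacts [rfl, hl g z]) ?_ _
      fun A p => ?_
    · rintro (b | z)
      exacts [le_rfl, (hlj z).trans j.le_succ]
    · rw [fwdDiff, mk_add, hφ, hφ, sub_eq_iff_eq_add', ← map_add]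
      refine congrArg _ (Eq.symm ?_)
      -- The value at `A ⨿ B` has label `0` on `B`, the difference has label `j + 1` there. With `(A
      -- ⨿ B) ⨿ Z` rebracketed, `hit_add_hit` compares the two labellings on the same set.
      have hl₀ : ∀ (g : G) (a : A.sum (B.sum Z)),
          sumLabel (fun _ => 0) (sumLabel (fun _ => 0) l) (g • a) =
            sumLabel (fun _ => 0) (sumLabel (fun _ => 0) l) a := by
        rintro g (a | b | z)
        exacts [rfl, rfl, hl g z]
      rw [hit_congr (sumAssoc A B Z) sumAssoc_bijective (q := sumElim p (sumElim r q))
        (l' := sumLabel (fun _ => 0) (sumLabel (fun _ => 0) l)) (hl' := hl₀)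
        (by rintro ((a | b) | z) <;> rfl) (by rintro ((a | b) | z) <;> rfl)]
      refine hit_add_hit (sumMap (idm A) (inr B Z)) ?_ ?_ ?_ ?_ ?_
      · rintro (a | z) (a' | z') h
        · exact congrArg Sum.inl (Sum.inl_injective h)
        · exact (Sum.inl_ne_inr h).elim
        · exact (Sum.inr_ne_inl h).elim
        · exact congrArg Sum.inr (Sum.inr_injective (Sum.inr_injective h))
      · rintro (a | b | z)
        · exact ⟨fun _ => (Nat.succ_ne_zero j).symm, fun _ => ⟨Sum.inl a, rfl⟩⟩
        · refine ⟨?_, fun h => (h rfl).elim⟩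
          rintro ⟨a | z, h⟩
          · exact (Sum.inl_ne_inr h).elim
          · exact (Sum.inr_ne_inl (Sum.inr_injective h)).elim
        · exact ⟨fun _ => (Nat.lt_succ_of_le (hlj z)).ne, fun _ => ⟨Sum.inr z, rfl⟩⟩
      · rintro (a | z) <;> rfl
      · rintro (a | z) <;> rfl
      · rintro (a | b | z) i hi
        · exact Iff.rfl
        · change 0 = i + 1 ↔ j + 1 = i + 1
          omega
        · exact Iff.rfl

/-- Before any difference is taken there are no increments and no conditions. The number of points
of `V` bounds every fibre, and one more difference gives zero. -/
lemma nm_isAlgebraicMap (f : V →[G] W) :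
    IsAlgebraicMap fun a => GrothendieckAddGroup.of (nm f a) := by
  refine ⟨Nat.card V + 1, degreeLT_of_hit f _ (j := 0) (fun y => ?_) (fromEmpty V) (fun _ => 0)
    (fun _ _ => rfl) (fun _ => le_rfl) _ fun A p => ?_⟩
  · rw [zero_add, Nat.lt_succ_iff]
    exact Nat.card_le_card_of_injective _ Subtype.val_injective
  · rw [hit_zero]
    exact congrArg _ (congrArg _ ((add_zero (mk p)).symm))

end OverClass

end BurnsideAlgebraic

/-! ### The semi-Tambara functor of crossed `G`-sets -/

section CrossedSemiTambara

variable {G : Type u} [Group G] {A B C P V W X Y Z : FinGSet G}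

/-! ### Products over the fibres of equivariant maps -/

section FiberProducts

variable {Q : Type u} [CommMonoid Q]

/-- Fibres over equal points are only propositionally the same type; this carries products across
such an equality. -/
lemma finprod_fiber_congr {f : X →[G] Y} {y y' : Y} (h : y = y')
    {F : {x : X // f x = y} → Q} {F' : {x : X // f x = y'} → Q}
    (hF : ∀ x hx hx', F ⟨x, hx⟩ = F' ⟨x, hx'⟩) : ∏ᶠ x, F x = ∏ᶠ x, F' x := by
  subst h
  exact finprod_congr fun x => hF x.1 x.2 x.2

/-- The fibre of a composite is partitioned by the fibres of the first map. The factor `F` may use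
the proof of membership, because it will be the value of a section defined only on that fibre. -/
lemma finprod_fiber_comp (f : X →[G] Y) (g : Y →[G] Z) (z : Z)
    (F : ∀ x, g (f x) = z → Q) :
    ∏ᶠ x : {x : X // g (f x) = z}, F x.1 x.2 =
      ∏ᶠ y : {y : Y // g y = z}, ∏ᶠ x : {x : X // f x = y},
        F x.1 ((congrArg g x.2).trans y.2) := by
  have := Fintype.ofFinite X
  have := Fintype.ofFinite Y
  classical
  simp only [finprod_eq_prod_of_fintype]
  rw [← Fintype.prod_sigma']
  exact Fintype.prod_equiv
    { toFun := fun x => ⟨⟨f x.1, x.2⟩, ⟨x.1, rfl⟩⟩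
      invFun := fun s => ⟨s.2.1, (congrArg g s.2.2).trans s.1.2⟩
      left_inv := fun _ => rfl
      right_inv := by
        rintro ⟨⟨y, hy⟩, ⟨x, hx⟩⟩
        obtain rfl : f x = y := hx
        rfl } _ _ fun _ => rfl

/-- In a pull-back square the fibre of `g'` over `y` is carried bijectively onto the fibre of `g`
over `f y`. -/
lemma finprod_fiber_pullback {f' : X →[G] A} {g' : X →[G] Y} {g : A →[G] B} {f : Y →[G] B}
    (h : IsPullback f' g' g f) {y : Y} {b : B} (hb : f y = b)
    {F : {x : X // g' x = y} → Q} {F' : {a : A // g a = b} → Q}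
    (hF : ∀ x hx hx', F ⟨x, hx⟩ = F' ⟨f' x, hx'⟩) : ∏ᶠ x, F x = ∏ᶠ x, F' x := by
  subst hb
  let k : {x : X // g' x = y} → {a : A // g a = f y} :=
    fun x => ⟨f' x.1, (h.1 x.1).trans (congrArg f x.2)⟩
  refine finprod_eq_of_bijective k ⟨?_, ?_⟩ fun x => hF x.1 x.2 (k x).2
  · rintro ⟨a, ha⟩ ⟨b, hb⟩ hab
    have hab : f' a = f' b := congrArg Subtype.val hab
    obtain ⟨c, -, hc⟩ := h.2 (f' a) y ((h.1 a).trans (congrArg f ha))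
    exact Subtype.ext ((hc a ⟨rfl, ha⟩).trans (hc b ⟨hab.symm, hb⟩).symm)
  · rintro ⟨x, hx⟩
    obtain ⟨a, ⟨ha, hy⟩, -⟩ := h.2 x y hx
    exact ⟨⟨a, hy⟩, Subtype.ext ha⟩

end FiberProducts

variable {Q : Type u} [CommMonoid Q] [MulDistribMulAction G Q]

lemma fixedTr_psnd (f : X →[G] Y) (r : P →[G] Y) (α : fiberProd f r →[G] Q) (s : P) :
    fixedTr (psnd f r) α s = ∏ᶠ x : {x : X // f x = r s}, α ⟨(x.1, s), x.2⟩ := by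
  rw [fixedTr_apply]
  refine finprod_fiber_pullback (isPullback_fiberProd f r) rfl ?_
  rintro ⟨⟨x, t⟩, hx⟩ rfl hx'
  rfl

/-! ### Transfers of crossed `G`-sets and their relations -/

namespace CrossedClass

/-- The labelling of `Π_f(A)` by the products of the labels of the values of the sections. -/
noncomputable def nmLabel (f : X →[G] Y) (p : A →[G] X) (m : A →[G] Q) : dprod f p →[G] Q :=
  fixedTr (psnd f (dproj f p)) (m.comp (deval f p))

lemma nmLabel_apply (f : X →[G] Y) (p : A →[G] X) (m : A →[G] Q) (s : dprod f p) :
    nmLabel f p m s = ∏ᶠ x : {x : X // f x = s.1}, m (s.2.1 x) := fixedTr_psnd _ _ _ _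

/-- The multiplicative transfer of crossed `G`-sets, `(A, m) ↦ (Π_f(A), σ ↦ ∏ m(σ(x)))`. -/
noncomputable def nm (f : X →[G] Y) : CrossedClass Q X → CrossedClass Q Y :=
  Quotient.map (fun a => ⟨dprod f a.p, dproj f a.p, nmLabel f a.p a.m⟩) (by
    rintro a b ⟨h, hh, hp, hm⟩
    refine ⟨dmap h hp, dmap_bijective hh, fun _ => rfl, fun s => ?_⟩
    dsimp only
    rw [nmLabel_apply, nmLabel_apply]
    exact finprod_congr fun x => hm _)

lemma nm_mk (f : X →[G] Y) (p : A →[G] X) (m : A →[G] Q) :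
    nm f (mk p m) = mk (dproj f p) (nmLabel f p m) := rfl

/-- A criterion for a `G`-set over `Y` to be a dependent product. -/
lemma nm_mk_eq {f : X →[G] Y} {p : A →[G] X} {m : A →[G] Q} {r : P →[G] Y} {k : P →[G] Q}
    (e : fiberProd f r →[G] A) (he : ∀ c, p (e c) = pfst f r c)
    (hinj : ∀ s t, r s = r t → (∀ x hs ht, e ⟨(x, s), hs⟩ = e ⟨(x, t), ht⟩) → s = t)
    (hsurj : ∀ y (σ : ∀ x, f x = y → A), (∀ x hx, p (σ x hx) = x) →
      ∃ s, ∃ hs : r s = y, ∀ x (hx : f x = r s), e ⟨(x, s), hx⟩ = σ x (hx.trans hs))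
    (hk : ∀ s, k s = ∏ᶠ x : {x : X // f x = r s}, m (e ⟨(x.1, s), x.2⟩)) :
    nm f (mk p m) = mk r k := by
  -- A point `s` is sent to the section `x ↦ e (x, s)`; `hinj` and `hsurj` are its injectivity and
  -- surjectivity.
  let φ : P →[G] dprod f p :=
    { toFun := fun s => ⟨r s, fun x => e ⟨(x.1, s), x.2⟩, fun x => he _⟩
      map_smul' := fun g s => SectionPair.ext (map_smul r g s) fun x hs ht => by
        refine Eq.trans ?_ (map_smul e g _)
        exact congrArg e (fiberProd_ext (smul_inv_smul g x).symm rfl) }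
  refine (sound φ ⟨fun s t hst => ?_, fun t => ?_⟩ (fun _ => rfl) fun s => ?_).symm
  · refine hinj s t (congrArg (dproj f p) hst) fun x hs ht => ?_
    -- The domain of a section depends on its base point, so the equality can be substituted only
    -- after `φ t` is replaced by a variable.
    have : ∀ t' : dprod f p, φ s = t' → ∀ (hs : f x = (φ s).1) (ht : f x = t'.1),
        (φ s).2.1 ⟨x, hs⟩ = t'.2.1 ⟨x, ht⟩ := by
      rintro _ rfl _ _
      rfl
    exact this _ hst hs ht
  · obtain ⟨s, hs, h⟩ := hsurj t.1 (fun x hx => t.2.1 ⟨x, hx⟩) fun x hx => t.2.2 ⟨x, hx⟩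
    exact ⟨s, SectionPair.ext hs fun x hx _ => h x hx⟩
  · exact (nmLabel_apply f p m (φ s)).trans (hk s).symm

/-- Pull-backs are unique up to isomorphism, so any convenient model computes the restriction. -/
lemma res_mk_eq {f : X →[G] Y} {p : A →[G] Y} {m : A →[G] Q} {f' : B →[G] A} {p' : B →[G] X}
    (h : IsPullback f' p' p f) : res f (mk p m) = mk p' (m.comp f') := by
  refine (sound (plift p f f' p' h.1) (plift_bijective (fun c d h1 h2 => ?_) fun x y hxy => ?_)
    (fun _ => rfl) fun _ => rfl).symm
  · obtain ⟨e, -, he⟩ := h.2 (f' c) (p' c) (h.1 c)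
    exact (he c ⟨rfl, rfl⟩).trans (he d ⟨h1.symm, h2.symm⟩).symm
  · exact (h.2 x y hxy).exists

lemma mk_mul_mk (p : A →[G] X) (q : B →[G] X) (m : A →[G] Q) (n : B →[G] Q) :
    mk p m * mk q n = mk (pstr p q) (star p q m n) := rfl

lemma res_mk (f : X →[G] Y) (p : A →[G] Y) (m : A →[G] Q) :
    res f (mk p m) = mk (psnd p f) (m.comp (pfst p f)) := rfl

lemma tr_mk (f : X →[G] Y) (p : A →[G] X) (m : A →[G] Q) :
    tr f (mk p m) = mk (comp f p) m := rfl

lemma res_id (a : CrossedClass Q X) : res (idm X) a = a := by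
  induction a using ind with | _ A p m
  refine res_mk_eq (f' := idm A) ⟨fun _ => rfl, fun x y h => ⟨x, ⟨rfl, h⟩, fun _ hb => hb.1⟩⟩

lemma res_comp (g : Y →[G] Z) (f : X →[G] Y) (a : CrossedClass Q Z) :
    res (comp g f) a = res f (res g a) := by
  induction a using ind with | _ A p m
  refine res_mk_eq (f' := comp (pfst p g) (pfst (psnd p g) f)) ⟨fun c => ?_, fun x y h => ?_⟩
  · exact c.1.1.2.trans (congrArg g c.2)
  · exact ⟨⟨(⟨(x, f y), h⟩, y), rfl⟩, ⟨rfl, rfl⟩, fun c hc =>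
      fiberProd_ext (fiberProd_ext hc.1 (c.2.trans (congrArg f hc.2))) hc.2⟩

lemma mackey {f' : A →[G] X} {g' : A →[G] B} {g : X →[G] Y} {f : B →[G] Y}
    (h : IsPullback f' g' g f) (a : CrossedClass Q X) :
    res f (tr g a) = tr g' (res f' a) := by
  induction a using ind with | _ C p m
  refine res_mk_eq (f' := pfst p f') ⟨fun c => ?_, fun x y hxy => ?_⟩
  · exact (congrArg g c.2).trans (h.1 _)
  · obtain ⟨a, ⟨ha, hy⟩, hu⟩ := h.2 (p x) y hxy
    refine ⟨⟨(x, a), ha.symm⟩, ⟨rfl, hy⟩, fun c hc => fiberProd_ext hc.1 (hu _ ⟨?_, hc.2⟩)⟩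
    exact c.2.symm.trans (congrArg p hc.1)

lemma subsingleton (hX : IsEmpty X) : Subsingleton (CrossedClass Q X) := by
  have : ∀ a : CrossedClass Q X, a = 0 := fun a => by
    induction a using ind with | _ A p m
    have : IsEmpty A := ⟨fun a => hX.false (p a)⟩
    exact mk_empty p m
  exact ⟨fun a b => (this a).trans (this b).symm⟩

/-- The inverse is the sum of the transfers along `i` and `j`. Since `i` and `j` are injective with
disjoint images, the Mackey condition shows that restriction after transfer along the same map is
the identity, and along different maps factors through the empty set. -/
lemma additive {i : X →[G] Z} {j : Y →[G] Z} (h : IsCoproduct i j) :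
    Bijective fun a : CrossedClass Q Z => (res i a, res j a) := by
  have hi : ∀ x x', i x = i x' → x = x' := fun x x' hx =>
    Sum.inl_injective (h.1 (a₁ := Sum.inl x) (a₂ := Sum.inl x') hx)
  have hj : ∀ x x', j x = j x' → x = x' := fun x x' hx =>
    Sum.inr_injective (h.1 (a₁ := Sum.inr x) (a₂ := Sum.inr x') hx)
  have hij : ∀ x y, i x ≠ j y := fun x y hxy =>
    Sum.inl_ne_inr (h.1 (a₁ := Sum.inl x) (a₂ := Sum.inr y) hxy)
  have hii : ∀ a : CrossedClass Q X, res i (tr i a) = a := fun a => by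
    rw [mackey (f' := idm X) (g' := idm X)
      ⟨fun _ => rfl, fun x y hxy => ⟨x, ⟨rfl, hi _ _ hxy⟩, fun _ hb => hb.1⟩⟩, res_id]
    induction a using ind with | _ A p m
    rfl
  have hjj : ∀ a : CrossedClass Q Y, res j (tr j a) = a := fun a => by
    rw [mackey (f' := idm Y) (g' := idm Y)
      ⟨fun _ => rfl, fun x y hxy => ⟨x, ⟨rfl, hj _ _ hxy⟩, fun _ hb => hb.1⟩⟩, res_id]
    induction a using ind with | _ A p m
    rfl
  have hij' : ∀ a : CrossedClass Q Y, res i (tr j a) = 0 := fun a => by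
    rw [mackey (f' := fromEmpty Y) (g' := fromEmpty X)
      ⟨fun x => isEmptyElim x, fun x y hxy => (hij _ _ hxy.symm).elim⟩,
      (subsingleton inferInstance).elim (res (fromEmpty Y) a) 0, map_zero]
  have hji' : ∀ a : CrossedClass Q X, res j (tr i a) = 0 := fun a => by
    rw [mackey (f' := fromEmpty X) (g' := fromEmpty Y)
      ⟨fun x => isEmptyElim x, fun x y hxy => (hij _ _ hxy).elim⟩,
      (subsingleton inferInstance).elim (res (fromEmpty X) a) 0, map_zero]
  -- A set over `Z` is the disjoint union of its parts over the images of `i` and `j`.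
  have hleft : ∀ a : CrossedClass Q Z, tr i (res i a) + tr j (res j a) = a := fun a => by
    induction a using ind with | _ A p m
    refine sound (sumElim (pfst p i) (pfst p j)) ⟨?_, fun a => ?_⟩ ?_ ?_
    · rintro (c | c) (d | d) hcd
      · have hcd : c.1.1 = d.1.1 := hcd
        exact congrArg Sum.inl (fiberProd_ext hcd (hi _ _
          (c.2.symm.trans ((congrArg p hcd).trans d.2))))
      · have hcd : c.1.1 = d.1.1 := hcd
        exact (hij _ _ (c.2.symm.trans ((congrArg p hcd).trans d.2))).elim
      · have hcd : c.1.1 = d.1.1 := hcd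
        exact (hij _ _ (d.2.symm.trans ((congrArg p hcd.symm).trans c.2))).elim
      · have hcd : c.1.1 = d.1.1 := hcd
        exact congrArg Sum.inr (fiberProd_ext hcd (hj _ _
          (c.2.symm.trans ((congrArg p hcd).trans d.2))))
    · obtain ⟨x | y, hx⟩ := h.2 (p a)
      · exact ⟨Sum.inl ⟨(a, x), hx.symm⟩, rfl⟩
      · exact ⟨Sum.inr ⟨(a, y), hx.symm⟩, rfl⟩
    · rintro (c | c)
      exacts [c.2, c.2]
    · rintro (c | c) <;> rfl
  refine ⟨fun a b hab => ?_, fun ab => ⟨tr i ab.1 + tr j ab.2, ?_⟩⟩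
  · rw [← hleft a, ← hleft b, (Prod.mk.inj hab).1, (Prod.mk.inj hab).2]
  · refine Prod.ext ?_ ?_
    · exact (map_add _ _ _).trans (by rw [hii, hij', add_zero])
    · exact (map_add _ _ _).trans (by rw [hji', hjj, zero_add])

lemma nm_one (f : X →[G] Y) : nm f (1 : CrossedClass Q X) = 1 := by
  refine nm_mk_eq (pfst f (idm Y)) (fun _ => rfl) (fun _ _ h _ => h) (fun y σ hσ => ?_)
    fun s => finprod_one.symm
  exact ⟨y, rfl, fun x hx => (hσ x hx).symm⟩

/-- A section of `A ×_X B` is a pair of sections of `A` and `B` over the same point, and the label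
of the pair splits because the product over a finite fibre is multiplicative. -/
lemma nm_mul (f : X →[G] Y) (a b : CrossedClass Q X) : nm f (a * b) = nm f a * nm f b := by
  induction a using ind with | _ A p m
  induction b using ind with | _ B q n
  rw [mk_mul_mk, nm_mk f p, nm_mk f q, mk_mul_mk]
  refine nm_mk_eq (plift p q
    (comp (deval f p) (plift f (dproj f p) (pfst _ _) (comp (pfst _ _) (psnd _ _)) fun c => c.2))
    (comp (deval f q) (plift f (dproj f q) (pfst _ _) (comp (psnd _ _) (psnd _ _))
      fun c => c.2.trans c.1.2.2))
    fun c => (c.1.2.1.1.2.2 ⟨c.1.1, c.2⟩).trans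
      (c.1.2.1.2.2.2 ⟨c.1.1, c.2.trans c.1.2.2⟩).symm) (fun c => c.1.2.1.1.2.2 _)
    (fun s t hst h => ?_) (fun y σ hσ => ?_) fun s => ?_
  · refine fiberProd_ext (SectionPair.ext hst fun x hs ht => ?_)
      (SectionPair.ext (s.2.symm.trans (hst.trans t.2)) fun x hs ht => ?_)
    · exact congrArg (pfst p q) (h x hs ht)
    · exact congrArg (psnd p q) (h x (hs.trans s.2.symm) (ht.trans t.2.symm))
  · exact ⟨⟨(⟨y, fun x => pfst p q (σ x.1 x.2), fun x => hσ x.1 x.2⟩,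
      ⟨y, fun x => psnd p q (σ x.1 x.2), fun x => (σ x.1 x.2).2.symm.trans (hσ x.1 x.2)⟩), rfl⟩,
      rfl, fun x hx => rfl⟩
  · refine Eq.trans ?_ (finprod_mul_distrib (Set.toFinite _) (Set.toFinite _)).symm
    refine congrArg₂ _ (nmLabel_apply f p m _) ((nmLabel_apply f q n _).trans ?_)
    exact finprod_fiber_congr s.2.symm fun _ _ _ => rfl

/-- The fibres of the identity are points, so a section is just a point of `A` and its label is a
product with one factor. -/
lemma nm_id (a : CrossedClass Q X) : nm (idm X) a = a := by
  induction a using ind with | _ A p m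
  refine nm_mk_eq (psnd (idm X) p) (fun c => c.2.symm) (fun s t hst h => ?_) (fun y σ hσ => ?_)
    fun s => ?_
  · exact h (p s) rfl hst
  · refine ⟨σ y rfl, hσ y rfl, fun x hx => ?_⟩
    obtain rfl : x = y := hx.trans (hσ y rfl)
    rfl
  · have : Unique {x : X // idm X x = p s} := ⟨⟨⟨p s, rfl⟩⟩, fun x => Subtype.ext x.2⟩
    exact (finprod_unique (fun _ : {x : X // idm X x = p s} => m s)).symm

/-- A section over a fibre of `g ∘ f` is a family, indexed by the corresponding fibre of `g`, of
sections over fibres of `f`. The evaluation is `(x, τ) ↦ τ(f x)(x)`, and the labels agree by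
grouping the product along `f`. -/
lemma nm_comp (g : Y →[G] Z) (f : X →[G] Y) (a : CrossedClass Q X) :
    nm (comp g f) a = nm g (nm f a) := by
  induction a using ind with | _ A p m
  rw [nm_mk f, nm_mk g]
  refine nm_mk_eq (comp (deval f p) (plift f (dproj f p) (pfst _ _)
    (comp (deval g (dproj f p)) (plift g (dproj g (dproj f p)) (comp f (pfst _ _)) (psnd _ _)
      fun c => c.2)) fun c => (c.1.2.2.2 ⟨f c.1.1, c.2⟩).symm))
    (fun c => (c.1.2.2.1 ⟨f c.1.1, c.2⟩).2.2 _) (fun s t hst h => ?_) (fun z σ hσ => ?_)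
    fun s => ?_
  · refine SectionPair.ext hst fun y hs ht =>
      SectionPair.ext ((s.2.2 ⟨y, hs⟩).trans (t.2.2 ⟨y, ht⟩).symm) fun x hx hx' => ?_
    obtain rfl : f x = y := hx.trans (s.2.2 ⟨y, hs⟩)
    exact h x hs ht
  · exact ⟨⟨z, fun y => ⟨y.1, fun x => σ x.1 ((congrArg g x.2).trans y.2), fun x => hσ _ _⟩,
      fun y => rfl⟩, rfl, fun x hx => rfl⟩
  · rw [nmLabel_apply]
    refine Eq.trans ?_ (finprod_fiber_comp f g s.1
      fun x hx => m ((s.2.1 ⟨f x, hx⟩).2.1 ⟨x, (s.2.2 ⟨f x, hx⟩).symm⟩)).symm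
    refine finprod_congr fun y => (nmLabel_apply f p m _).trans ?_
    refine finprod_fiber_congr (s.2.2 y) ?_
    obtain ⟨y, hy⟩ := y
    intro x hx hx'
    -- The inner section at `y` has base point `y` only up to the equality `s.2.2`. With `y` and the
    -- proofs generalized, `f x = y` can be substituted.
    have : ∀ y (hy : g y = s.1) (hx : f x = (s.2.1 ⟨y, hy⟩).1), f x = y →
        ∀ hy' : g (f x) = s.1, m ((s.2.1 ⟨y, hy⟩).2.1 ⟨x, hx⟩) =
            m ((s.2.1 ⟨f x, hy'⟩).2.1 ⟨x, (s.2.2 ⟨f x, hy'⟩).symm⟩) := by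
      rintro y hy hx rfl hy'
      rfl
    exact this y hy hx hx' _

/-- The fibre of `g'` over `y` is identified with that of `g` over `f y`, and under this
identification sections of the pulled-back set are sections of the original one. -/
lemma nm_mackey {f' : B →[G] X} {g' : B →[G] C} {g : X →[G] Y} {f : C →[G] Y}
    (h : IsPullback f' g' g f) (a : CrossedClass Q X) :
    res f (nm g a) = nm g' (res f' a) := by
  induction a using ind with | _ A p m
  rw [nm_mk, res_mk, res_mk]
  refine (nm_mk_eq (plift p f' (comp (deval g p) (plift g (dproj g p) (comp f' (pfst _ _))
    (comp (pfst _ _) (psnd _ _)) fun c => (h.1 _).trans ((congrArg f c.2).trans c.1.2.2.symm)))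
    (pfst _ _) fun c => c.1.2.1.1.2.2 _) (fun _ => rfl) (fun s t hst H => ?_)
    (fun y σ hσ => ?_) fun s => ?_).symm
  · refine fiberProd_ext (SectionPair.ext (s.2.trans ((congrArg f hst).trans t.2.symm))
      fun x hs ht => ?_) hst
    obtain ⟨b, ⟨rfl, hb⟩, -⟩ := h.2 x s.1.2 (hs.trans s.2)
    exact congrArg (pfst p f') (H b hb (hb.trans hst))
  -- The inverse of the bijection of fibres, along which a section over the fibre of `g'` is carried
  -- to one over the fibre of `g`.
  · choose b hb _ using fun x : {x : X // g x = f y} => h.2 x.1 y x.2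
    refine ⟨⟨(⟨f y, fun x => pfst p f' (σ (b x) (hb x).2), fun x => ?_⟩, y), rfl⟩, rfl,
      fun x hx => ?_⟩
    · exact (σ (b x) (hb x).2).2.trans ((congrArg f' (hσ _ _)).trans (hb x).1)
    · refine fiberProd_ext ?_ (hσ x hx).symm
      have hx' : g' x = y := hx
      obtain ⟨c, -, hc⟩ := h.2 (f' x) y ((h.1 x).trans (congrArg f hx))
      have : b ⟨f' x, (h.1 x).trans (congrArg f hx)⟩ = x :=
        (hc _ (hb _)).trans (hc x ⟨rfl, hx⟩).symm
      have key : ∀ z (hz : g' z = y), z = x → pfst p f' (σ z hz) = pfst p f' (σ x hx) := by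
        rintro z hz rfl
        rfl
      exact key _ _ this
  · refine (nmLabel_apply g p m _).trans ?_
    refine (finprod_fiber_pullback h s.2.symm fun x hx hx' => ?_).symm
    rfl

lemma tr_res_of_bijective (f : X →[G] Y) (hf : Bijective f) (a : CrossedClass Q Y) :
    tr f (res f a) = a := by
  rw [← mackey (f' := f) (g' := f) (g := idm Y) (f := idm Y)
    ⟨fun _ => rfl, fun x y hxy => ?_⟩, res_id]
  · induction a using ind with | _ A p m
    rfl
  · obtain ⟨a, rfl⟩ := hf.2 x
    exact ⟨a, ⟨rfl, hxy⟩, fun b hb => hf.1 hb.1⟩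

/-- Distributivity: for `A → Z → X`, a section of `A` over a fibre of `η` is the same as a section
of `Z` together with a lift of it to `A`. -/
lemma exponential_dprod (η : X →[G] Y) (ξ : Z →[G] X) (a : CrossedClass Q Z) :
    tr (dproj η ξ) (nm (psnd η (dproj η ξ)) (res (deval η ξ) a)) = nm η (tr ξ a) := by
  induction a using ind with | _ A p m
  rw [res_mk, nm_mk, tr_mk, tr_mk]
  refine (nm_mk_eq (comp (pfst p (deval η ξ)) (comp (deval (psnd η (dproj η ξ)) _)
    (plift (psnd η (dproj η ξ)) (dproj _ _)
      (plift η (dproj η ξ) (pfst _ _) (comp (dproj _ _) (psnd _ _)) fun c => c.2)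
      (psnd _ _) fun c => rfl))) (fun c => ?_) (fun s t hst h => ?_)
    (fun y σ hσ => ?_) fun s => ?_).symm
  · have h1 := (c.1.2.2.1 ⟨⟨(c.1.1, c.1.2.1), c.2⟩, rfl⟩).2
    have h2 := c.1.2.2.2 ⟨⟨(c.1.1, c.1.2.1), c.2⟩, rfl⟩
    exact (congrArg ξ (h1.trans (congrArg (deval η ξ) h2))).trans (c.1.2.1.2.2 _)
  · obtain ⟨s₁, s₂, hs₂⟩ := s
    obtain ⟨t₁, t₂, ht₂⟩ := t
    -- The underlying section of `Z` is recovered by applying `p` to the values in `A`. Once it is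
    -- fixed, the lifts can be compared pointwise.
    have h12 : s₁ = t₁ := by
      refine SectionPair.ext hst fun x hs ht => ?_
      have e1 := (s₂ ⟨⟨(x, s₁), hs⟩, rfl⟩).2.trans (congrArg (deval η ξ) (hs₂ _))
      have e2 := (t₂ ⟨⟨(x, t₁), ht⟩, rfl⟩).2.trans (congrArg (deval η ξ) (ht₂ _))
      exact (e1.symm.trans (congrArg p (h x hs ht))).trans e2
    subst h12
    refine SectionPair.ext rfl ?_
    rintro ⟨⟨x, s⟩, hx⟩ (rfl : s = s₁) _
    exact fiberProd_ext (h x hx hx) ((hs₂ _).trans (ht₂ _).symm)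
  · let s₁ : dprod η ξ := ⟨y, fun x => p (σ x.1 x.2), fun x => hσ x.1 x.2⟩
    refine ⟨⟨s₁, fun c => ⟨(σ c.1.1.1 (c.1.2.trans (congrArg (dproj η ξ) c.2)), c.1), ?_⟩,
      fun c => rfl⟩, rfl, fun x hx => rfl⟩
    obtain ⟨⟨⟨x, s⟩, hx⟩, hs⟩ := c
    obtain rfl : s = s₁ := hs
    rfl
  · refine (nmLabel_apply _ _ _ _).trans ?_
    refine finprod_fiber_pullback (isPullback_fiberProd η (dproj η ξ)) rfl ?_
    rintro ⟨⟨x, t⟩, hx⟩ (rfl : t = s.1) hx'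
    rfl

/-- The isomorphisms `b` and `c` with the standard diagram form a pull-back square, so the Mackey
condition reduces to `exponential_dprod`, up to a restriction and transfer along the bijection `b`
which cancel. -/
lemma exponential {X' Y' : FinGSet G} {η : X →[G] Y} {ξ : Z →[G] X} {ζ : X' →[G] Z}
    {η' : X' →[G] Y'} {υ : Y' →[G] Y} (h : IsExponential η ξ ζ η' υ) (a : CrossedClass Q Z) :
    tr υ (nm η' (res ζ a)) = nm η (tr ξ a) := by
  obtain ⟨b, c, hb, hc, h1, h2, h3⟩ := h
  obtain rfl : comp (dproj η ξ) b = υ := MulActionHom.ext h1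
  obtain rfl : comp (deval η ξ) c = ζ := MulActionHom.ext h3
  have hsq : IsPullback c η' (psnd η (dproj η ξ)) b := by
    refine ⟨h2, fun x y hxy => ?_⟩
    obtain ⟨z, rfl⟩ := hc.2 x
    exact ⟨z, ⟨rfl, hb.1 ((h2 z).symm.trans hxy)⟩, fun _ hw => hc.1 hw.1⟩
  rw [res_comp, ← nm_mackey hsq, ← exponential_dprod]
  generalize nm (psnd η (dproj η ξ)) (res (deval η ξ) a) = d
  have : tr (comp (dproj η ξ) b) (res b d) = tr (dproj η ξ) (tr b (res b d)) := by
    induction res b d using ind with | _ A p m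
    rfl
  rw [this, tr_res_of_bijective b hb]

end CrossedClass

variable (G Q) in
/-- The semi-Tambara functor of isomorphism classes of crossed `G`-sets. -/
noncomputable def crossedData : TambaraData.{u, u + 1} G where
  obj X := CrossedClass Q X
  res f := CrossedClass.res f
  tr f := CrossedClass.tr f
  nm f := CrossedClass.nm f

lemma crossedData_isSemiTambara : (crossedData G Q).IsSemiTambara where
  additive :=
    { res_id := fun _ => CrossedClass.res_id
      res_comp := CrossedClass.res_comp
      tr_id := fun _ => CrossedClass.ind fun _ _ _ => rfl
      tr_comp := fun _ _ => CrossedClass.ind fun _ _ _ => rfl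
      mackey := fun _ _ _ _ => CrossedClass.mackey
      subsingleton := fun _ => CrossedClass.subsingleton
      additive := fun _ _ => CrossedClass.additive }
  multiplicative :=
    { res_id := fun _ => CrossedClass.res_id
      res_comp := CrossedClass.res_comp
      tr_id := fun _ => CrossedClass.nm_id
      tr_comp := CrossedClass.nm_comp
      mackey := fun _ _ _ _ => CrossedClass.nm_mackey
      subsingleton := fun _ => CrossedClass.subsingleton
      additive := fun _ _ => CrossedClass.additive }
  nm_one := CrossedClass.nm_one
  nm_mul := CrossedClass.nm_mul
  exponential _ _ _ _ _ := CrossedClass.exponential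

end CrossedSemiTambara

/-! ### The crossed Burnside ring functor as a ring completion -/

section CrossedCompletion

open Algebra

variable {G : Type u} [Group G] {Q : Type u} [CommMonoid Q] [MulDistribMulAction G Q]
  {A B X Y : FinGSet G}

/-! ### The transfer of the crossed Burnside ring as an algebraic extension -/

section Finite

variable [Finite Q]

/-- The crossed set `(p, m)` over `X` is the transfer along the projection `X × Q → X` of the
crossed set `((p, m) : A → X × Q, m)`. The exponential formula for that projection produces the
composite through `Π_f(X × Q)`. -/
lemma CrossedClass.nm_eq_equivOver_symm (f : X →[G] Y) (a : CrossedClass Q X) :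
    nm f a = (equivOver Q Y).symm (OverClass.tr (muMap Q f)
      (OverClass.nm (psnd f (dproj f (fst X (monoidSet G Q))))
        (OverClass.res (deval f (fst X (monoidSet G Q))) (equivOver Q X a)))) := by
  induction a using ind with | _ A p m
  refine (exponential_dprod f (fst X (monoidSet G Q))
    (mk (pair p (Y := monoidSet G Q) m) m)).symm.trans ?_
  -- Both sides have the same underlying `G`-set; only the labels need comparison. On the left the
  -- label multiplies the values of `m` at the chosen points of `A`, on the right `muMap` multiplies
  -- the `Q`-coordinates of the section of `X × Q` which these points lift.
  refine sound (idm _) bijective_id (fun _ => rfl) fun s => Eq.symm ?_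
  refine (nmLabel_apply _ _ _ s).trans ?_
  refine finprod_fiber_pullback (isPullback_fiberProd f (dproj f (fst X (monoidSet G Q)))) rfl ?_
  intro c hc hx
  have h1 := (s.2.1 ⟨c, hc⟩).2.trans
    (congrArg (deval f (fst X (monoidSet G Q))) (s.2.2 ⟨c, hc⟩))
  refine (congrArg Prod.snd h1).trans ?_
  obtain ⟨⟨x, t⟩, hx⟩ := c
  obtain rfl : t = s.1 := hc
  rfl

lemma burnsideNm_isAlgebraicExtension (f : X →[G] Y) :
    IsAlgebraicExtension (fun a => GrothendieckAddGroup.of (OverClass.nm f a)) (burnsideNm f) :=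
  (OverClass.nm_isAlgebraicMap f).algExt_spec

lemma crossedNm_of (f : X →[G] Y) (a : CrossedClass Q X) :
    crossedNm Q f (K0.of a) = K0.of (CrossedClass.nm f a) := by
  rw [CrossedClass.nm_eq_equivOver_symm]
  have h₁ := groupMap_of (CrossedClass.equivOver Q X).toAddMonoidHom a
  have h₂ := (congrArg (groupMap (OverClass.res (deval f (fst X (monoidSet G Q))))) h₁).trans
    (groupMap_of _ _)
  have h₃ := (congrArg (burnsideNm (psnd f (dproj f (fst X (monoidSet G Q))))) h₂).trans
    ((burnsideNm_isAlgebraicExtension _).2 _)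
  have h₄ := (congrArg (groupMap (OverClass.tr (muMap Q f))) h₃).trans (groupMap_of _ _)
  exact (congrArg (groupMap (CrossedClass.equivOver Q Y).symm.toAddMonoidHom) h₄).trans
    (groupMap_of _ _)

/-- The only non-additive step of the composite is `burnsideNm`, and additive maps on either side
preserve algebraicity. -/
lemma crossedNm_isAlgebraicMap (f : X →[G] Y) : IsAlgebraicMap (crossedNm Q f) := by
  have h := (burnsideNm_isAlgebraicExtension (psnd f (dproj f (fst X (monoidSet G Q))))).1
  have h₁ := h.comp_addHom (groupMap (OverClass.res (deval f (fst X (monoidSet G Q)))))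
  have h₂ := h₁.comp_addHom (groupMap (CrossedClass.equivOver Q X).toAddMonoidHom)
  have h₃ := h₂.addHom_comp (groupMap (OverClass.tr (muMap Q f)))
  exact h₃.addHom_comp (groupMap (CrossedClass.equivOver Q Y).symm.toAddMonoidHom)

variable (G Q) in
-- Algebraicity is inherited from the Burnside group: the transfer of crossed sets is the
-- restriction of the algebraic map `crossedNm` along the additive map to the completion.
lemma crossedData_hasAlgebraicNm : (crossedData G Q).HasAlgebraicNm := fun X Y f => by
  have := (crossedNm_isAlgebraicMap (Q := Q) f).comp_addHom K0.of
  simp only [crossedNm_of] at this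
  exact this

lemma crossedNm_eq_completionNm (f : X →[G] Y) :
    crossedNm Q f = (crossedData G Q).completionNm f :=
  K0.alg_ext (crossedNm_isAlgebraicMap f) ((crossedData_hasAlgebraicNm G Q).isAlgebraicMap f)
    fun a => (crossedNm_of f a).trans ((crossedData_hasAlgebraicNm G Q).completionNm_of f a).symm

variable (G Q) in
lemma crossedBurnside_eq_completion : crossedBurnside G Q = (crossedData G Q).completion := by
  have h : (fun {X Y : FinGSet G} (f : X →[G] Y) => crossedNm Q f) =
      fun {X Y : FinGSet G} (f : X →[G] Y) => (crossedData G Q).completionNm f := by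
    funext X Y f
    exact crossedNm_eq_completionNm f
  exact congrArg (fun n : ∀ {X Y : FinGSet G}, (X →[G] Y) → K0 (CrossedClass Q X) →
    K0 (CrossedClass Q Y) => (TambaraData.mk (fun X => K0 (CrossedClass Q X))
      (fun f => K0.map (CrossedClass.res f)) (fun f => K0.addMap (CrossedClass.tr f)) n :
        TambaraData G)) h

variable (G Q) in
lemma crossedBurnside_isTambara : (crossedBurnside G Q).IsTambara :=
  crossedBurnside_eq_completion G Q ▸
    crossedData_isSemiTambara.completion (crossedData_hasAlgebraicNm G Q)

end Finite

/-! ### Comparison with the Tambarization of the fixed point functor -/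

/-- The glued element is obtained by choice from additivity, so it is identified with the union of
labellings through its two restrictions. This is the one point of the comparison with crossed sets
that does not hold by definition. -/
lemma fixedPointFunctor_glue (m : A →[G] Q) (n : B →[G] Q) :
    (fixedPointFunctor G Q).glue (A := A) (B := B) m n = CrossedClass.union m n :=
  (fixedPointFunctor G Q).sum_ext (A := A) (B := B)
    ((fixedPointFunctor G Q).res_inl_glue (A := A) (B := B) m n)
    ((fixedPointFunctor G Q).res_inr_glue (A := A) (B := B) m n)

/-- The semirings of the Tambarization of `P_Q` are those of crossed `G`-sets. -/
noncomputable def smEquiv (X : FinGSet G) :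
    SM (fixedPointFunctor G Q) X ≃+* CrossedClass Q X where
  toFun := Quotient.map (fun a => ⟨a.A, a.p, a.m⟩) (by
    rintro a b ⟨f, hf, hp, hm⟩
    exact ⟨f, hf, hp, fun x => DFunLike.congr_fun (F := a.A →[G] Q) hm x⟩)
  invFun := Quotient.map (fun a => ⟨a.A, a.p, a.m⟩) (by
    rintro a b ⟨f, hf, hp, hm⟩
    exact ⟨f, hf, hp, MulActionHom.ext hm⟩)
  left_inv a := by
    induction a using SM.ind with | _ A p m
    rfl
  right_inv a := by
    induction a using CrossedClass.ind with | _ A p m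
    rfl
  map_mul' a b := by
    induction a using SM.ind with | _ A p m
    induction b using SM.ind with | _ B q n
    rfl
  map_add' a b := by
    induction a using SM.ind with | _ A p m
    induction b using SM.ind with | _ B q n
    exact congrArg (CrossedClass.mk (sumElim p q)) (fixedPointFunctor_glue m n)

lemma smEquiv_res (f : X →[G] Y) (a : SM (fixedPointFunctor G Q) Y) :
    smEquiv X (SM.res f a) = CrossedClass.res f (smEquiv Y a) := by
  induction a using SM.ind with | _ A p m
  rfl

lemma smEquiv_tr (f : X →[G] Y) (a : SM (fixedPointFunctor G Q) X) :
    smEquiv Y (SM.tr f a) = CrossedClass.tr f (smEquiv X a) := by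
  induction a using SM.ind with | _ A p m
  rfl

lemma smEquiv_nm (f : X →[G] Y) (a : SM (fixedPointFunctor G Q) X) :
    smEquiv Y (SM.nm f a) = CrossedClass.nm f (smEquiv X a) := by
  induction a using SM.ind with | _ A p m
  rfl

variable (G Q) in
lemma semiTambarization_isSemiTambara :
    (semiTambarization (fixedPointFunctor G Q)).IsSemiTambara :=
  crossedData_isSemiTambara.of_equiv (S := semiTambarization (fixedPointFunctor G Q))
    (T := crossedData G Q) smEquiv smEquiv_res smEquiv_tr smEquiv_nm

variable (G Q) in
lemma semiTambarization_hasAlgebraicNm [Finite Q] :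
    (semiTambarization (fixedPointFunctor G Q)).HasAlgebraicNm := fun X Y f => by
  have := ((crossedData_hasAlgebraicNm G Q X Y f).comp_addHom
    (smEquiv X).toAddEquiv.toAddMonoidHom).addHom_comp
    (K0.mapEquiv (smEquiv (Q := Q) Y)).symm.toAddMonoidHom
  have h : (fun a : SM (fixedPointFunctor G Q) X => K0.of (SM.nm f a)) = fun a =>
      (K0.mapEquiv (smEquiv Y)).symm (K0.of (CrossedClass.nm f (smEquiv X a))) :=
    funext fun a => ((K0.mapEquiv (smEquiv Y)).symm_apply_eq.2 (by
      rw [K0.mapEquiv_of, smEquiv_nm])).symm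
  change IsAlgebraicMap fun a : SM (fixedPointFunctor G Q) X => K0.of (SM.nm f a)
  rw [h]
  exact this

lemma mapEquiv_smEquiv_res (f : X →[G] Y) (a : K0 (SM (fixedPointFunctor G Q) Y)) :
    K0.mapEquiv (smEquiv X) (K0.map (SM.res f) a) =
      K0.map (CrossedClass.res f) (K0.mapEquiv (smEquiv Y) a) := by
  obtain ⟨s, t, rfl⟩ := K0.exists_sub a
  simp only [map_sub, K0.map_of, K0.mapEquiv_of, smEquiv_res]

lemma mapEquiv_smEquiv_tr (f : X →[G] Y) (a : K0 (SM (fixedPointFunctor G Q) X)) :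
    K0.mapEquiv (smEquiv Y) (K0.addMap (SM.tr f) a) =
      K0.addMap (CrossedClass.tr f) (K0.mapEquiv (smEquiv X) a) := by
  obtain ⟨s, t, rfl⟩ := K0.exists_sub a
  simp only [map_sub, K0.addMap_of, K0.mapEquiv_of, smEquiv_tr]

/-- Both sides are algebraic on the completion, so the comparison reduces to `smEquiv_nm` on classes
of objects. -/
lemma mapEquiv_smEquiv_completionNm [Finite Q] (f : X →[G] Y)
    (a : K0 (SM (fixedPointFunctor G Q) X)) :
    K0.mapEquiv (smEquiv Y)
        ((semiTambarization (fixedPointFunctor G Q)).completionNm f a) =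
      crossedNm Q f (K0.mapEquiv (smEquiv X) a) :=
  congrFun (K0.alg_ext
    (((semiTambarization_hasAlgebraicNm G Q).isAlgebraicMap f).addHom_comp
      (K0.mapEquiv (smEquiv Y)).toAddMonoidHom)
    ((crossedNm_isAlgebraicMap f).comp_addHom
      (K0.mapEquiv (smEquiv X)).toAddMonoidHom)
    fun a => by
      rw [(semiTambarization_hasAlgebraicNm G Q).completionNm_of]
      refine (K0.mapEquiv_of _ _).trans ((congrArg _ (smEquiv_nm f a)).trans ?_)
      refine (crossedNm_of f _).symm.trans (congrArg _ ?_)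
      exact (K0.mapEquiv_of _ _).symm) a

end CrossedCompletion

/-- Families of isomorphisms of rings compatible with the structure maps are isomorphisms of
Tambara functors. -/
def TambaraFunctor.isoOfEquiv {G : Type u} [Group G] {S T : TambaraFunctor.{u, w} G}
    (e : ∀ X, S.toData.obj X ≃+* T.toData.obj X)
    (hres : ∀ {X Y : FinGSet G} (f : X →[G] Y) (a : S.toData.obj Y),
      e X (S.toData.res f a) = T.toData.res f (e Y a))
    (htr : ∀ {X Y : FinGSet G} (f : X →[G] Y) (a : S.toData.obj X),
      e Y (S.toData.tr f a) = T.toData.tr f (e X a))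
    (hnm : ∀ {X Y : FinGSet G} (f : X →[G] Y) (a : S.toData.obj X),
      e Y (S.toData.nm f a) = T.toData.nm f (e X a)) : S ≅ T where
  hom := (⟨fun X => (e X : S.toData.obj X →+* T.toData.obj X), hres, htr, hnm⟩ :
    TambaraFunctor.Hom S T)
  inv := (⟨fun X => ((e X).symm : T.toData.obj X →+* S.toData.obj X),
    fun {X Y} f a => (e X).symm_apply_eq.2
      ((congrArg _ ((e Y).apply_symm_apply a).symm).trans (hres f _).symm),
    fun {X Y} f a => (e Y).symm_apply_eq.2
      ((congrArg _ ((e X).apply_symm_apply a).symm).trans (htr f _).symm),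
    fun {X Y} f a => (e Y).symm_apply_eq.2
      ((congrArg _ ((e X).apply_symm_apply a).symm).trans (hnm f _).symm)⟩ :
    TambaraFunctor.Hom T S)
  hom_inv_id := TambaraFunctor.Hom.ext (funext fun X => RingHom.ext (e X).symm_apply_apply)
  inv_hom_id := TambaraFunctor.Hom.ext (funext fun X => RingHom.ext (e X).apply_symm_apply)

end CrossedBurnside

open CrossedBurnside
theorem mainTheorem6 {G : Type u} [Group G] [Finite G] (Q : Type u) [CommMonoid Q]
    [MulDistribMulAction G Q] [Finite Q] :
    (∀ {X Y : FinGSet G} (f : X →[G] Y),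
      ∃! g, IsAlgebraicExtension
        (fun a : SM (fixedPointFunctor G Q) X => K0.of (SM.nm f a)) g) ∧
    (∀ {X Y : FinGSet G} (f : X →[G] Y),
      ∃! g, IsAlgebraicExtension
        (fun a : OverClass X => Algebra.GrothendieckAddGroup.of (OverClass.nm f a)) g) ∧
    ∃ (hT : (tambarization (fixedPointFunctor G Q)).IsTambara)
      (hΩ : (crossedBurnside G Q).IsTambara)
      (φ : (⟨tambarization (fixedPointFunctor G Q), hT⟩ : TambaraFunctor G) ≅
        ⟨crossedBurnside G Q, hΩ⟩),
      ∀ {X A : FinGSet G} (p : A →[G] X) (m : A →[G] Q),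
        φ.hom.app X (K0.of (SM.mk p m)) = K0.of (CrossedClass.mk p m) := by
  refine ⟨fun {X Y} f => (semiTambarization_hasAlgebraicNm G Q X Y f).existsUnique_extension,
    fun f => (OverClass.nm_isAlgebraicMap f).existsUnique_extension,
    (semiTambarization_isSemiTambara G Q).completion (semiTambarization_hasAlgebraicNm G Q),
    crossedBurnside_isTambara G Q,
    TambaraFunctor.isoOfEquiv (fun X => K0.mapEquiv (smEquiv X)) mapEquiv_smEquiv_res
      mapEquiv_smEquiv_tr mapEquiv_smEquiv_completionNm,
    fun {X A} p m => K0.mapEquiv_of (smEquiv X) (SM.mk p m)⟩
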